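/- **Setting.** Let $R$ be a finite, principal, commutative local ring of odd prime characteristic $p$, with maximal ideal $\mathfrak m=Rx$ of nilpotency degree $\ell\ge 1$. Let $A=R[t]/(t^2-x)=R\oplus Ry$, $y^2=x$, with involution $(r+sy)^*=r-sy$; put $\mathfrak r=Ay$ and $\mathfrak i=\mathfrak r^{\ell}$. Let $V$ be a free $A$-module of finite rank $m\ge 1$, $h:V\times V\to A$ a non-degenerate hermitian form ($A$-linear in the second variable, $h(v,u)=h(u,v)^*$), $U$ its unitary group, and $N=\{z\in A^\times : zz^*=1\}$, identified with a central subgroup of $U$ by letting $z$ act as $v\mapsto zv$. Let $\lambda:R^+\to\mathbb C^\times$ be a linear character whose kernel contains no non-zero ideal of $R$, and let $\mu(r+sy)=\lambda(2s)$ on $A^+$. **The Weil module.** Let $V_0=\mathfrak iV$ and let $H=A\times V$ be the Heisenberg group, with $(a,v)(b,w)=(a+b+h(v,w),v+w)$, on which $U$ acts by ${}^g(a,v)=(a,gv)$. Let $Z=\mathbb C\zeta$ be the one-dimensional module of $(A,V_0)\rtimes U$ on which $(a,u)g$ acts by $\mu(a)$, let $X=\mathrm{ind}_{(A,V_0)\rtimes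 U}^{H\rtimes U}Z$, regarded as a $U$-module, and let $e_v=(0,v)\otimes\zeta$ for $v\in V$. **Characters.** For $v\in V$ let $C(v)=\{g\in U: gv\equiv v \bmod V_0\}$ and $B(v)=C(v)N$, and let $\beta_v:C(v)\to\mathbb C^\times$ be the linear character $\beta_v(g)=\mu(h(gv,v))$. Choose a linear character $\delta_v$ of $N$ extending the restriction of $\beta_v$ to $C(v)\cap N$, and let $\gamma_v(gz)=\beta_v(g)\delta_v(z)$ for $g\in C(v)$, $z\in N$, a linear character of $B(v)$. Let $G$ be the group of linear characters of $N$ trivial on $N\cap(1+\mathfrak i)$. A vector $v$ is primitive if $v\notin\mathfrak rV$; for such $v$ one has $C(v)\cap N= N\cap(1+\mathfrak i)$, so $\phi\in G$ may be viewed as the linear character $gz\mapsto\phi(z)$ of $B(v)$ trivial on $C(v)$. Let $S$ be a set of representatives of the primitive vectors under the equivalence relation: $v\sim w$ if $gv\equiv w\bmod \mathfrak iV$ for some $g\in U$. For $s\in S$ and $\phi\in G$ let $\mathrm{Top}(s)$ be the $U$-submodule of $X$ generated by $e_s$, let $$E_{\phi,s}=\sum_{z\in N}\phi(z^{-1})\gamma_s(z^{-1})\,z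 e_s ,$$ and let $\mathrm{Top}(\phi,s)$ be the $U$-submodule of $\mathrm{Top}(s)$ generated by $E_{\phi,s}$. **Theorem.** Fix $s\in S$ (and any choice of $\delta_s$ as above). Then: (a) for every $\phi\in G$, the character of $\mathrm{Top}(\phi,s)$ is the induced character $\mathrm{ind}_{B(s)}^{U}\,\phi\gamma_s$; (b) for every $\phi\in G$, the $U$-module $\mathrm{Top}(\phi,s)$ is irreducible; (c) the $U$-modules $\mathrm{Top}(\phi,s)$, $\phi\in G$, are pairwise non-isomorphic; (d) $\mathrm{Top}(s)=\bigoplus_{\phi\in G}\mathrm{Top}(\phi,s)$. -/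

import Mathlib

noncomputable section

open scoped Classical

namespace RamifiedWeil

set_option linter.unusedSectionVars false

universe u v

/-! ### Generalities on groups, linear characters and representations -/

section General

variable {U : Type*} [Group U]

/-- The subrepresentation generated by a vector: the span of its orbit. -/
def generatedBy {X : Type*} [AddCommGroup X] [Module ℂ X] (ρ : Representation ℂ U X) (w : X) :
    Subrepresentation ρ where
  toSubmodule := Submodule.span ℂ (Set.range fun g : U => ρ g w)
  apply_mem_toSubmodule g u hu := by
    induction hu using Submodule.span_induction with
    | mem u hu =>
      obtain ⟨k, rfl⟩ := hu
      exact Submodule.subset_span ⟨g * k, by simp⟩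
    | zero => simp
    | add a b _ _ ha hb => rw [map_add]; exact Submodule.add_mem _ ha hb
    | smul c a _ ha => rw [map_smul]; exact Submodule.smul_mem _ c ha

/-- The character of a (finite) group `U` induced from the linear character `θ` of a
subgroup `B`: `g ↦ |B|⁻¹ ∑ θ(t⁻¹ g t)`, over those `t` in `U` with `t⁻¹ g t` in `B`. -/
def inducedCharacter (B : Subgroup U) (θ : B →* ℂˣ) (g : U) : ℂ :=
  (Nat.card B : ℂ)⁻¹ *
    ∑ᶠ t : U, if ht : t⁻¹ * g * t ∈ B then ((θ ⟨t⁻¹ * g * t, ht⟩ : ℂˣ) : ℂ) else 0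

variable {N : Type*} [CommGroup N] {C : Subgroup U} {i : N →* U}

theorem exists_decomp (hi : ∀ z g, Commute (i z) g) (b : ↥(C ⊔ i.range)) :
    ∃ (c : C) (z : N), (c : U) * i z = b := by
  have : i.range.Normal := ⟨by
    rintro _ ⟨z, rfl⟩ g
    refine ⟨z, ?_⟩
    rw [← (hi z g).eq]; group⟩
  have hb := b.2
  rw [Subgroup.mem_sup_of_normal_right] at hb
  obtain ⟨c, hc, _, ⟨z, rfl⟩, h⟩ := hb
  exact ⟨⟨c, hc⟩, z, h⟩

theorem decomp_unique {β : C →* ℂˣ} {δ : N →* ℂˣ}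
    (hβδ : ∀ z (hz : i z ∈ C), δ z = β ⟨i z, hz⟩)
    {c c' : C} {z z' : N} (h : (c : U) * i z = c' * i z') :
    β c * δ z = β c' * δ z' := by
  have h1 : i (z * z'⁻¹) = ((c⁻¹ * c' : C) : U) := by
    simp only [map_mul, map_inv, Subgroup.coe_mul, Subgroup.coe_inv]
    rw [eq_inv_mul_iff_mul_eq, ← mul_assoc, h]; group
  have h2 := hβδ (z * z'⁻¹) (h1 ▸ (c⁻¹ * c').2)
  have h3 : (⟨i (z * z'⁻¹), h1 ▸ (c⁻¹ * c').2⟩ : C) = c⁻¹ * c' := Subtype.ext h1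
  rw [h3] at h2
  simp only [map_mul, map_inv] at h2
  rw [← div_eq_mul_inv, div_eq_iff_eq_mul] at h2
  rw [h2]
  simp [mul_assoc]

/-- Let `i : N → U` be a homomorphism with central image, `β` a linear character of a subgroup
`C` of `U` and `δ` a linear character of `N`, such that `β` and `δ` agree where both make sense.
This is the linear character `g z ↦ β(g) δ(z)` of `C N`. -/
def glue (hi : ∀ z g, Commute (i z) g) (β : C →* ℂˣ) (δ : N →* ℂˣ)
    (hβδ : ∀ z (hz : i z ∈ C), δ z = β ⟨i z, hz⟩) : ↥(C ⊔ i.range) →* ℂˣ :=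
  MonoidHom.mk' (fun b => β (exists_decomp hi b).choose *
      δ (exists_decomp hi b).choose_spec.choose) <| by
    intro a b
    have ha := (exists_decomp hi a).choose_spec.choose_spec
    have hb := (exists_decomp hi b).choose_spec.choose_spec
    have hab := (exists_decomp hi (a * b)).choose_spec.choose_spec
    generalize (exists_decomp hi a).choose_spec.choose = z1 at *
    generalize (exists_decomp hi a).choose = c1 at *
    generalize (exists_decomp hi b).choose_spec.choose = z2 at *
    generalize (exists_decomp hi b).choose = c2 at *
    have key : ((c1 * c2 : C) : U) * i (z1 * z2) = ((a * b : ↥(C ⊔ i.range)) : U) := by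
      rw [Subgroup.coe_mul, Subgroup.coe_mul, ← ha, ← hb, map_mul]
      calc (c1 : U) * c2 * (i z1 * i z2) = c1 * (c2 * i z1) * i z2 := by group
        _ = c1 * (i z1 * c2) * i z2 := by rw [(hi z1 c2).eq]
        _ = _ := by group
    rw [decomp_unique hβδ (hab.trans key.symm)]
    simp only [map_mul]
    exact mul_mul_mul_comm _ _ _ _

theorem glue_apply (hi : ∀ z g, Commute (i z) g) (β : C →* ℂˣ) (δ : N →* ℂˣ)
    (hβδ : ∀ z (hz : i z ∈ C), δ z = β ⟨i z, hz⟩) (b : ↥(C ⊔ i.range)) (c : C) (z : N)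
    (h : (c : U) * i z = b) : glue hi β δ hβδ b = β c * δ z :=
  decomp_unique hβδ ((exists_decomp hi b).choose_spec.choose_spec.trans h.symm)

theorem mem_smul_top_of_repr {A M J : Type*} [CommRing A] [AddCommGroup M] [Module A M]
    (b : Module.Basis J A M) (I : Ideal A) {w : M} (hw : ∀ j, b.repr w j ∈ I) :
    w ∈ I • (⊤ : Submodule A M) := by
  rw [← b.linearCombination_repr w, Finsupp.linearCombination_apply]
  exact Submodule.sum_mem _ fun j _ => Submodule.smul_mem_smul (hw j) trivial

theorem repr_mem_of_mem_smul_top {A M J : Type*} [CommRing A] [AddCommGroup M] [Module A M]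
    (b : Module.Basis J A M) (I : Ideal A) {w : M} (hw : w ∈ I • (⊤ : Submodule A M)) (j : J) :
    b.repr w j ∈ I := by
  refine Submodule.smul_induction_on hw (fun a ha u _ => ?_) (fun u u' h1 h2 => ?_)
  · simpa using I.mul_mem_right _ ha
  · simpa using I.add_mem h1 h2

end General

/-! ### The ring `A = R[y]`, `y² = x` -/

section Ring

variable {R : Type u} [CommRing R]

/-- `A = R[t]/(t² - x)`: its elements are `r + s y` with unique `r s : R`, where `y² = x`. Its
`star` is the involution `(r + s y)* = r - s y`. -/
abbrev Ext (x : R) : Type u := QuadraticAlgebra R x 0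

variable (x : R)

/-- The element `y` of `A`. -/
def yElt : Ext x := ⟨0, 1⟩

/-- The ideal `𝔯 = A y`. -/
def rIdeal : Ideal (Ext x) := Ideal.span {yElt x}

/-- The nilpotency degree `ℓ` of the maximal ideal `𝔪` of `R`: the least `ℓ` with `𝔪 ^ ℓ = 0`. -/
def nilDegree (R : Type u) [CommRing R] [IsLocalRing R] : ℕ :=
  nilpotencyClass (IsLocalRing.maximalIdeal R)

/-- The ideal `𝔦 = 𝔯 ^ ℓ` of `A`. -/
def iIdeal [IsLocalRing R] : Ideal (Ext x) := rIdeal x ^ nilDegree R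

/-- The additive map `d : A → R`, `d (r + s y) = 2 s`. -/
def dMap : Ext x →+ R where
  toFun a := 2 * a.im
  map_zero' := by simp
  map_add' a b := by simp [mul_add]

/-- The additive character `μ = λ ∘ d` of `A`. -/
def muChar (lam : AddChar R ℂˣ) : AddChar (Ext x) ℂˣ := lam.compAddMonoidHom (dMap x)

/-- An additive character is primitive if its kernel contains no nonzero ideal. -/
def IsPrimitiveChar (lam : AddChar R ℂˣ) : Prop :=
  ∀ I : Ideal R, (∀ a ∈ I, lam a = 1) → I = ⊥

/-- The norm-one group `N = {z ∈ Aˣ | z z* = 1}`. -/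
abbrev normOne : Type u := ↥(unitary (Ext x))

/-- The group `G` of linear characters of `N` trivial on `N ∩ (1 + 𝔦)`. -/
def charGroup [IsLocalRing R] : Subgroup (normOne x →* ℂˣ) where
  carrier := {φ | ∀ z : normOne x, (z : Ext x) - 1 ∈ iIdeal x → φ z = 1}
  one_mem' _ _ := rfl
  mul_mem' ha hb z hz := by simp [ha z hz, hb z hz]
  inv_mem' ha z hz := by simp [ha z hz]

variable {x}

theorem muChar_eq_one (lam : AddChar R ℂˣ) {a : Ext x} (ha : star a = a) :
    muChar x lam a = 1 := by
  have h : -a.im = a.im := by simpa using congrArg QuadraticAlgebra.im ha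
  have : dMap x a = 0 := by
    change 2 * a.im = 0
    rw [two_mul]; nth_rewrite 1 [← h]; simp
  simp [muChar, AddChar.compAddMonoidHom_apply, this]

theorem yElt_sq : yElt x ^ 2 = algebraMap R (Ext x) x := by
  ext <;> simp [yElt, pow_two]

theorem star_yElt : star (yElt x) = -yElt x := by
  ext <;> simp [yElt]

variable [IsLocalRing R] [Finite R] [hx : Fact (IsLocalRing.maximalIdeal R = Ideal.span {x})]

theorem pow_nilDegree : x ^ nilDegree R = 0 := by
  have h1 : IsNilpotent (IsLocalRing.maximalIdeal R) := by
    rw [← IsLocalRing.jacobson_eq_maximalIdeal ⊥ bot_ne_top]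
    exact IsArtinianRing.isNilpotent_jacobson_bot (R := R)
  have h2 : IsLocalRing.maximalIdeal R ^ nilDegree R = 0 := pow_nilpotencyClass h1
  have h3 : x ^ nilDegree R ∈ IsLocalRing.maximalIdeal R ^ nilDegree R :=
    Ideal.pow_mem_pow (hx.out ▸ Ideal.mem_span_singleton_self x) _
  rw [h2] at h3
  simpa using h3

theorem star_mul_eq_zero {a b : Ext x} (ha : a ∈ iIdeal x) (hb : b ∈ iIdeal x) :
    star a * b = 0 := by
  rw [iIdeal, rIdeal, Ideal.span_singleton_pow, Ideal.mem_span_singleton'] at ha hb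
  obtain ⟨a, rfl⟩ := ha
  obtain ⟨b, rfl⟩ := hb
  have : yElt x ^ nilDegree R * yElt x ^ nilDegree R = 0 := by
    rw [← pow_add, ← two_mul, pow_mul, yElt_sq, ← map_pow, pow_nilDegree, map_zero]
  rw [star_mul, star_pow, star_yElt, neg_pow]
  calc _ = (-1) ^ nilDegree R * star a * b *
        (yElt x ^ nilDegree R * yElt x ^ nilDegree R) := by ring
    _ = 0 := by rw [this, mul_zero]

theorem isUnit_of_notMem {a : Ext x} (ha : a ∉ rIdeal x) : IsUnit a := by
  have h1 : IsUnit a.re := by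
    by_contra h
    apply ha
    have : a.re ∈ IsLocalRing.maximalIdeal R := h
    rw [hx.out, Ideal.mem_span_singleton'] at this
    obtain ⟨c, hc⟩ := this
    rw [rIdeal, Ideal.mem_span_singleton']
    refine ⟨⟨a.im, c⟩, ?_⟩
    ext <;> simp [yElt, ← hc, mul_comm]
  have h2 : x * a.im ^ 2 ∈ IsLocalRing.maximalIdeal R :=
    Ideal.mul_mem_right _ _ (hx.out ▸ Ideal.mem_span_singleton_self x)
  have h3 : IsUnit (a.re ^ 2 - x * a.im ^ 2) := by
    by_contra h
    have h4 : a.re ^ 2 ∈ IsLocalRing.maximalIdeal R := by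
      simpa using Ideal.add_mem _ (show _ ∈ IsLocalRing.maximalIdeal R from h) h2
    exact h4 (h1.pow 2)
  have h4 : a * star a = algebraMap R (Ext x) (a.re ^ 2 - x * a.im ^ 2) := by
    rw [← QuadraticAlgebra.algebraMap_norm_eq_mul_star]
    congr 1
    simp [QuadraticAlgebra.norm]; ring
  exact isUnit_of_mul_isUnit_left (h4 ▸ h3.map (algebraMap R (Ext x)))

end Ring

/-! ### Hermitian forms, unitary and Heisenberg groups -/

section Form

variable {R : Type u} [CommRing R] (x : R)
variable (V : Type v) [AddCommGroup V] [Module (Ext x) V]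

/-- A non-degenerate hermitian form `h : V × V → A`: it is `A`-linear in the second variable,
`h (v, u) = h (u, v)*`, and `v ↦ h (v, -)` is a bijection from `V` onto its dual. -/
structure HermForm where
  form : V →ₗ⋆[Ext x] V →ₗ[Ext x] Ext x
  herm : ∀ u w, form w u = star (form u w)
  nondeg : Function.Bijective form

/-- The submodule `V₀ = 𝔦 V`. -/
def V0 [IsLocalRing R] : Submodule (Ext x) V := iIdeal x • ⊤

variable {V}

/-- A vector is primitive if it is not in `𝔯 V`. -/
def IsPrimitiveVec (w : V) : Prop := w ∉ rIdeal x • (⊤ : Submodule (Ext x) V)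

variable {x} (h : HermForm x V)

/-- The unitary group of `h`. -/
def unitaryGrp : Subgroup (V ≃ₗ[Ext x] V) where
  carrier := {g | ∀ u w, h.form (g u) (g w) = h.form u w}
  one_mem' _ _ := rfl
  mul_mem' ha hb u w := by
    rw [LinearEquiv.mul_apply, LinearEquiv.mul_apply, ha, hb]
  inv_mem' {g} hg u w := by
    have := hg (g⁻¹ u) (g⁻¹ w)
    rw [← LinearEquiv.mul_apply, ← LinearEquiv.mul_apply, mul_inv_cancel] at this
    exact this.symm

/-- The Heisenberg group of `h`: pairs `(a, v)` with
`(a, v) (b, w) = (a + b + h (v, w), v + w)`. -/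
@[ext]
structure Heis (h : HermForm x V) where
  scal : Ext x
  vec : V

namespace Heis

instance : Mul (Heis h) := ⟨fun k l => ⟨k.scal + l.scal + h.form k.vec l.vec, k.vec + l.vec⟩⟩
instance : One (Heis h) := ⟨⟨0, 0⟩⟩
instance : Inv (Heis h) := ⟨fun k => ⟨-k.scal + h.form k.vec k.vec, -k.vec⟩⟩

@[simp] theorem mul_scal (k l : Heis h) :
    (k * l).scal = k.scal + l.scal + h.form k.vec l.vec := rfl
@[simp] theorem mul_vec (k l : Heis h) : (k * l).vec = k.vec + l.vec := rfl
@[simp] theorem one_scal : (1 : Heis h).scal = 0 := rfl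
@[simp] theorem one_vec : (1 : Heis h).vec = 0 := rfl
@[simp] theorem inv_scal (k : Heis h) : k⁻¹.scal = -k.scal + h.form k.vec k.vec := rfl
@[simp] theorem inv_vec (k : Heis h) : k⁻¹.vec = -k.vec := rfl

instance : Group (Heis h) := Group.ofLeftAxioms
  (fun a b c => by
    ext1
    · simp only [mul_scal, mul_vec, map_add, LinearMap.add_apply]; ring
    · simp [add_assoc])
  (fun a => by ext1 <;> simp)
  (fun a => by ext1 <;> simp)

end Heis

/-- The action `ᵍ(a, v) = (a, g v)` of the unitary group on the Heisenberg group. -/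
def heisAct : unitaryGrp h →* MulAut (Heis h) where
  toFun g :=
    { toFun := fun k => ⟨k.scal, g.1 k.vec⟩
      invFun := fun k => ⟨k.scal, g.1.symm k.vec⟩
      left_inv := fun k => by simp
      right_inv := fun k => by simp
      map_mul' := fun k l => by
        ext1
        · simp [g.2 k.vec l.vec]
        · simp }
  map_one' := by ext k <;> rfl
  map_mul' g g' := by ext k <;> rfl

/-- The group `H ⋊ U`. -/
abbrev HU : Type (max u v) := Heis h ⋊[heisAct h] unitaryGrp h

end Form

/-! ### The Weil module -/

section Weil

variable {R : Type u} [CommRing R] [IsLocalRing R] {x : R}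
variable {V : Type v} [AddCommGroup V] [Module (Ext x) V] (h : HermForm x V)

theorem smul_mem_V0_iff (g : V ≃ₗ[Ext x] V) (w : V) : g w ∈ V0 x V ↔ w ∈ V0 x V := by
  have key : ∀ (f : V ≃ₗ[Ext x] V) (w : V), w ∈ V0 x V → f w ∈ V0 x V := by
    intro f w hw
    have := Submodule.mem_map_of_mem (f := (f : V →ₗ[Ext x] V)) hw
    rw [V0, Submodule.map_smul''] at this
    exact Submodule.smul_mono le_rfl le_top this
  exact ⟨fun hw => by simpa using key g.symm _ hw, key g w⟩

/-- The subgroup `(A, V₀) ⋊ U` of `H ⋊ U`. -/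
def inducingSubgroup : Subgroup (HU h) where
  carrier := {k | k.left.vec ∈ V0 x V}
  one_mem' := (V0 x V).zero_mem
  mul_mem' {k l} hk hl :=
    (V0 x V).add_mem hk ((smul_mem_V0_iff (k.right : V ≃ₗ[Ext x] V) l.left.vec).2 hl)
  inv_mem' {k} hk :=
    (smul_mem_V0_iff ((k.right⁻¹ : unitaryGrp h) : V ≃ₗ[Ext x] V) _).2
      ((V0 x V).neg_mem hk)

/-- `C(v) = {g ∈ U | g v ≡ v mod V₀}`. -/
def Cgrp (w : V) : Subgroup (unitaryGrp h) where
  carrier := {g | g.1 w - w ∈ V0 x V}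
  one_mem' := by simp
  mul_mem' {a b} ha hb := by
    have h1 := (smul_mem_V0_iff a.1 _).2 hb
    have h2 := (V0 x V).add_mem h1 ha
    simpa using h2
  inv_mem' {a} ha := by
    have h1 := (V0 x V).neg_mem ((smul_mem_V0_iff (a⁻¹).1 _).2 ha)
    have h2 : (a⁻¹).1 (a.1 w) = w := by
      rw [← LinearEquiv.mul_apply, ← Subgroup.coe_mul]; simp
    rw [map_sub, h2, neg_sub] at h1
    exact h1

/-- The embedding of `N` in `U`: the element `z` acts as `v ↦ z v`. -/
def normOneHom : normOne x →* unitaryGrp h where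
  toFun z := ⟨LinearEquiv.ofLinearMap ((z : Ext x) • LinearMap.id)
      ((star z : Ext x) • LinearMap.id)
      (by ext w; simp [smul_smul])
      (by ext w; simp [smul_smul]), fun u w => by
        have hz : (z : Ext x) * star (z : Ext x) = 1 := Unitary.mul_star_self_of_mem z.2
        change h.form ((z : Ext x) • u) ((z : Ext x) • w) = _
        rw [LinearMap.map_smulₛₗ₂, map_smul, smul_eq_mul, smul_eq_mul, ← mul_assoc,
          starRingEnd_apply, mul_comm (star _), hz, one_mul]⟩
  map_one' := by ext w; simp
  map_mul' z z' := by ext w; simp [smul_smul, mul_comm]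

@[simp] theorem normOneHom_apply (z : normOne x) (w : V) :
    (normOneHom h z).1 w = (z : Ext x) • w := rfl

theorem normOneHom_commute (z : normOne x) (g : unitaryGrp h) : Commute (normOneHom h z) g := by
  ext w; simp

/-- `B(v) = C(v) N`. -/
abbrev Bgrp (w : V) : Subgroup (unitaryGrp h) := Cgrp h w ⊔ (normOneHom h).range

/-- The relation `v ∼ w`: there is `g` in `U` with `g v ≡ w mod 𝔦 V`. -/
def EquivMod (v w : V) : Prop := ∃ g : unitaryGrp h, g.1 v - w ∈ V0 x V

/-- `S` is a set of representatives for `∼` on the set of primitive vectors. -/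
def IsRepresentatives (S : Set V) : Prop :=
  (∀ s ∈ S, IsPrimitiveVec x s) ∧
    ∀ w : V, IsPrimitiveVec x w → ∃! s, s ∈ S ∧ EquivMod h w s

theorem form_add_left (a b c : V) : h.form (a + b) c = h.form a c + h.form b c := by simp

variable [Finite R] [hx : Fact (IsLocalRing.maximalIdeal R = Ideal.span {x})]

theorem form_eq_zero {u w : V} (hu : u ∈ V0 x V) (hw : w ∈ V0 x V) : h.form u w = 0 := by
  rw [V0] at hu hw
  refine Submodule.smul_induction_on hu (fun a ha u _ => ?_) (fun u u' h1 h2 => by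
    rw [form_add_left, h1, h2, add_zero])
  refine Submodule.smul_induction_on hw (fun b hb w _ => ?_) (fun w w' h1 h2 => by
    rw [map_add, h1, h2, add_zero])
  rw [LinearMap.map_smulₛₗ₂, map_smul, smul_eq_mul, smul_eq_mul, ← mul_assoc,
    starRingEnd_apply, star_mul_eq_zero ha hb, zero_mul]

variable (lam : AddChar R ℂˣ)

/-- The linear character `(a, u) g ↦ μ(a)` of `(A, V₀) ⋊ U`. -/
def inducingChar : inducingSubgroup h →* ℂˣ :=
  MonoidHom.mk' (fun k => muChar x lam k.1.left.scal) <| by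
    intro k l
    have : h.form k.1.left.vec (k.1.right.1 l.1.left.vec) = 0 :=
      form_eq_zero h k.2 ((smul_mem_V0_iff k.1.right.1 _).2 l.2)
    change muChar x lam (k.1.left.scal + l.1.left.scal +
      h.form k.1.left.vec (k.1.right.1 l.1.left.vec)) = _
    rw [this, add_zero, AddChar.map_add_eq_mul]

/-- The one-dimensional representation of `(A, V₀) ⋊ U` on `Z = ℂ ζ`, with `ζ = 1`. -/
def Zrep : Representation ℂ (inducingSubgroup h) ℂ where
  toFun k := ((inducingChar h lam k : ℂˣ) : ℂ) • LinearMap.id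
  map_one' := by ext; simp
  map_mul' k l := by ext; simp [mul_comm]

/-- The Weil module `X`, induced from `(A, V₀) ⋊ U` to `H ⋊ U`. -/
abbrev WeilModule : Type (max u v) :=
  Representation.IndV (inducingSubgroup h).subtype (Zrep h lam)

/-- The action of `U` on the Weil module. -/
def weilRep : Representation ℂ (unitaryGrp h) (WeilModule h lam) :=
  (Representation.ind (inducingSubgroup h).subtype (Zrep h lam)).comp SemidirectProduct.inr

/-- The vector `e_v = (0, v) ⊗ ζ` of `X`. (Mathlib writes `g ⊗ ζ` as `mk g⁻¹ ζ`.) -/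
def eVec (w : V) : WeilModule h lam :=
  Representation.IndV.mk (inducingSubgroup h).subtype (Zrep h lam)
    (SemidirectProduct.inl (⟨0, w⟩ : Heis h))⁻¹ 1

/-- The linear character `β_v(g) = μ(h(g v, v))` of `C(v)`. -/
def betaChar (w : V) : Cgrp h w →* ℂˣ :=
  MonoidHom.mk' (fun g => muChar x lam (h.form (g.1.1 w) w)) <| by
    intro a b
    have ha := a.2
    have hb := b.2
    have hw : muChar x lam (h.form w w) = 1 := muChar_eq_one lam (h.herm w w).symm
    have key : ∀ g : V, h.form g w = h.form (g - w) w + h.form w w := fun g => by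
      rw [← form_add_left, sub_add_cancel]
    have hainv : (a⁻¹).1.1 w - w ∈ V0 x V := (a⁻¹).2
    have haa : a.1.1 ((a⁻¹).1.1 w) = w := by
      rw [← LinearEquiv.mul_apply, ← Subgroup.coe_mul, ← Subgroup.coe_mul]; simp
    have h1 : h.form (a.1.1 (b.1.1 w - w)) w = h.form (b.1.1 w - w) w := by
      have h0 : h.form (a.1.1 (b.1.1 w - w)) (a.1.1 ((a⁻¹).1.1 w)) =
          h.form (b.1.1 w - w) ((a⁻¹).1.1 w) := a.1.2 _ _
      rw [haa] at h0
      rw [h0]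
      have h2 := form_eq_zero h hb hainv
      rw [map_sub, sub_eq_zero] at h2
      exact h2
    have h3 : h.form (((a * b : Cgrp h w).1.1) w) w =
        h.form (b.1.1 w - w) w + h.form (a.1.1 w) w := by
      rw [← h1, ← form_add_left, map_sub, sub_add_cancel]; rfl
    rw [h3, AddChar.map_add_eq_mul, mul_comm, key (b.1.1 w), AddChar.map_add_eq_mul, hw, mul_one]

/-- `δ` is an extension to `N` of the restriction of `β_v` to `C(v) ∩ N`. -/
def ExtendsBeta (w : V) (δ : normOne x →* ℂˣ) : Prop :=
  ∀ z (hz : normOneHom h z ∈ Cgrp h w), δ z = betaChar h lam w ⟨normOneHom h z, hz⟩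

/-- The linear character `γ_v(g z) = β_v(g) δ_v(z)` of `B(v) = C(v) N`. -/
def gammaChar (w : V) (δ : normOne x →* ℂˣ) (hδ : ExtendsBeta h lam w δ) : Bgrp h w →* ℂˣ :=
  glue (normOneHom_commute h) (betaChar h lam w) δ hδ

theorem sub_one_mem [Module.Free (Ext x) V] {w : V} (hw : IsPrimitiveVec x w) {z : normOne x}
    (hz : normOneHom h z ∈ Cgrp h w) : (z : Ext x) - 1 ∈ iIdeal x := by
  have h1 : ((z : Ext x) - 1) • w ∈ iIdeal x • (⊤ : Submodule (Ext x) V) := by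
    rw [sub_smul, one_smul]; exact hz
  let b := Module.Free.chooseBasis (Ext x) V
  obtain ⟨j, hj⟩ : ∃ j, b.repr w j ∉ rIdeal x := by
    by_contra! hall
    exact hw (mem_smul_top_of_repr b _ hall)
  have h2 := repr_mem_of_mem_smul_top b _ h1 j
  rw [map_smul, Finsupp.smul_apply, smul_eq_mul] at h2
  exact (Ideal.mul_unit_mem_iff_mem _ (isUnit_of_notMem hj)).1 h2

/-- A linear character `φ` in `G`, considered as the linear character `g z ↦ φ(z)` of
`B(v) = C(v) N` trivial on `C(v)`, for a primitive vector `v`. -/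
def inflate [Module.Free (Ext x) V] (w : V) (hw : IsPrimitiveVec x w) (φ : charGroup x) :
    Bgrp h w →* ℂˣ :=
  glue (normOneHom_commute h) 1 φ.1 fun z hz => φ.2 z (sub_one_mem h hw hz)

/-- `E_{φ,v} = ∑ φ(z⁻¹) γ_v(z⁻¹) z e_v`, the sum being over `z` in `N`. -/
def EVec (w : V) (δ : normOne x →* ℂˣ) (hδ : ExtendsBeta h lam w δ) (φ : charGroup x) :
    WeilModule h lam :=
  ∑ᶠ z : normOne x,
    ((φ.1 z⁻¹ * gammaChar h lam w δ hδ
        ⟨normOneHom h z⁻¹, Subgroup.mem_sup_right ⟨z⁻¹, rfl⟩⟩ : ℂˣ) : ℂ) •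
      weilRep h lam (normOneHom h z) (eVec h lam w)

/-- `Top(v)`: the `U`-submodule generated by `e_v`. -/
def TopAt (w : V) : Subrepresentation (weilRep h lam) :=
  generatedBy (weilRep h lam) (eVec h lam w)

/-- `Top(φ, v)`: the `U`-submodule generated by `E_{φ,v}`. -/
def TopChar (w : V) (δ : normOne x →* ℂˣ) (hδ : ExtendsBeta h lam w δ) (φ : charGroup x) :
    Subrepresentation (weilRep h lam) :=
  generatedBy (weilRep h lam) (EVec h lam w δ hδ φ)

end Weil

end RamifiedWeil

end

noncomputable section

open scoped Classical

namespace RamifiedWeil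

set_option linter.unusedSectionVars false

universe u v

/-! ### Representations generated by an eigenvector -/

section Clifford

variable {U : Type*} [Group U] [Finite U] {X : Type*} [AddCommGroup X] [Module ℂ X]

/-! The argument is Clifford theory, arranged around explicit vectors. Let `L` be the normal
subgroup of `U` generated by the central group `N` and the congruence subgroup, the kernel of the
action of `U` on `V / V₀`. The group `C(s)` acts on `e_s` through `β_s`, and averaging over `N`
makes `E_{φ,s}` an eigenvector of `B(s) = C(s) N` with character `θ = φ γ_s`.

The main point is that `B(s)` is the whole stabilizer of the restriction of `θ` to `L`. On the
congruence subgroup the conjugate of `θ` by `g` is `k ↦ μ(h(k g s, g s))`. Since `𝔦² = 0`, there are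
transvections `1 + T` with coefficients in `𝔦`. Evaluated on them, this character determines the
products `h(gs, v₂) h(v₁, gs)` modulo `𝔦`, because `λ` is primitive and the annihilator of `𝔦` lies
in `𝔦`. These products determine `g s` modulo `V₀` up to an element of `N`, so only `g` in `B(s)`
fixes the restriction (`exists_smul_sub_mem`, `conj_character_ne_of_notMem`).

Let `P` be the projection onto the eigenspace of `L` for the restriction of `θ`. It sends each
translate `g E_{φ,s}` to zero if `g ∉ B(s)`, and to `θ(g) E_{φ,s}` otherwise. Hence `P` has rank one
on `Top(φ, s)`, and the sum of its conjugates over `U` is the scalar `|B(s)|` there. Irreducibility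
follows, and taking traces gives the induced character. For distinct `φ` the characters already
differ on the central group `N`, so they are not conjugate; this gives non-isomorphism and
independence. Fourier inversion on `N / (N ∩ (1 + 𝔦))` recovers `e_s` from the `E_{φ,s}`, so the sum
is all of `Top(s)`. -/

/-- The projection onto the `χ`-eigenspace of a finite subgroup `L`, for a linear character `χ`. -/
def eigenProj (ρ : Representation ℂ U X) {L : Subgroup U} (χ : L →* ℂˣ) : X →ₗ[ℂ] X :=
  (Nat.card L : ℂ)⁻¹ • ∑ᶠ l : L, ((χ l⁻¹ : ℂˣ) : ℂ) • ρ l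

theorem sum_hom_eq_zero {L : Type*} [Group L] [Fintype L] (χ : L →* ℂˣ) (hχ : χ ≠ 1) :
    ∑ l, ((χ l : ℂˣ) : ℂ) = 0 := by
  refine sum_hom_units_eq_zero ((Units.coeHom ℂ).comp χ) fun h => hχ ?_
  ext l
  simpa using DFunLike.congr_fun h l

theorem eigenProj_apply (ρ : Representation ℂ U X) {L : Subgroup U} [Fintype L] (χ : L →* ℂˣ)
    (w : X) : eigenProj ρ χ w = (Nat.card L : ℂ)⁻¹ • ∑ l : L, ((χ l⁻¹ : ℂˣ) : ℂ) • ρ l w := by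
  rw [eigenProj, finsum_eq_sum_of_fintype]
  simp [LinearMap.sum_apply]

/-- Orthogonality of distinct linear characters of `L`. -/
theorem eigenProj_of_ne {ρ : Representation ℂ U X} {L : Subgroup U} {χ χ' : L →* ℂˣ} {w : X}
    (hw : ∀ l : L, ρ l w = ((χ' l : ℂˣ) : ℂ) • w) (hne : χ' ≠ χ) : eigenProj ρ χ w = 0 := by
  have := Fintype.ofFinite L
  have h1 := sum_hom_eq_zero (χ' / χ) fun h =>
    hne (MonoidHom.ext fun l => div_eq_one.1 (DFunLike.congr_fun h l))
  rw [eigenProj_apply]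
  simp_rw [hw, smul_smul]
  rw [← Finset.sum_smul]
  convert smul_zero _
  convert zero_smul ℂ w
  rw [← h1]
  refine Finset.sum_congr rfl fun l _ => ?_
  rw [MonoidHom.div_apply, div_eq_mul_inv, mul_comm, map_inv, Units.val_mul]

theorem eigenProj_self {ρ : Representation ℂ U X} {L : Subgroup U} {χ : L →* ℂˣ} {w : X}
    (hw : ∀ l : L, ρ l w = ((χ l : ℂˣ) : ℂ) • w) : eigenProj ρ χ w = w := by
  have := Fintype.ofFinite L
  rw [eigenProj_apply]
  have h1 : ∀ l : L, ((χ l⁻¹ : ℂˣ) : ℂ) • ρ l w = w := fun l => by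
    rw [hw, smul_smul, ← Units.val_mul, ← map_mul]; simp
  simp_rw [h1]
  rw [Finset.sum_const, Finset.card_univ, ← Nat.card_eq_fintype_card, ← Nat.cast_smul_eq_nsmul ℂ,
    smul_smul, inv_mul_cancel₀ (Nat.cast_ne_zero.2 Nat.card_pos.ne'), one_smul]

theorem eigenProj_mem {ρ : Representation ℂ U X} {L : Subgroup U} (χ : L →* ℂˣ)
    (W : Subrepresentation ρ) {w : X} (hw : w ∈ W.toSubmodule) :
    eigenProj ρ χ w ∈ W.toSubmodule := by
  have := Fintype.ofFinite L
  rw [eigenProj_apply]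
  exact Submodule.smul_mem _ _ <| Submodule.sum_mem _ fun l _ =>
    Submodule.smul_mem _ _ (W.apply_mem_toSubmodule _ hw)

theorem map_eigenProj {Y : Type*} [AddCommGroup Y] [Module ℂ Y] {ρ : Representation ℂ U X}
    {σ : Representation ℂ U Y} (f : X →ₗ[ℂ] Y) (hf : ∀ g w, f (ρ g w) = σ g (f w))
    {L : Subgroup U} (χ : L →* ℂˣ) (w : X) : f (eigenProj ρ χ w) = eigenProj σ χ (f w) := by
  have := Fintype.ofFinite L
  simp [eigenProj_apply, map_sum, hf]

/-- Write `l g = g (g⁻¹ l g)`: translating by `g` conjugates the character, and normality keeps the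
conjugate on `L`. -/
theorem eigen_translate {ρ : Representation ℂ U X} {L : Subgroup U} [L.Normal] {χ : L →* ℂˣ}
    {w : X} (hw : ∀ l : L, ρ l w = ((χ l : ℂˣ) : ℂ) • w) (g : U) (l : L) :
    ρ l (ρ g w) = ((χ.comp (MulAut.conjNormal g⁻¹).toMonoidHom l : ℂˣ) : ℂ) • ρ g w := by
  have h1 := hw (MulAut.conjNormal g⁻¹ l)
  rw [MulAut.conjNormal_apply] at h1
  rw [MonoidHom.comp_apply, ← map_smul]
  change _ = ρ g (((χ (MulAut.conjNormal g⁻¹ l) : ℂˣ) : ℂ) • w)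
  rw [← h1, ← Module.End.mul_apply, ← Module.End.mul_apply, ← map_mul, ← map_mul]
  group

/-- `θ` is a linear character of the subgroup `B` by which `B` acts on the vector `w`, and `B` is
the stabilizer of the restriction of `θ` to the normal subgroup `L`. -/
structure IsCliffordVec (ρ : Representation ℂ U X) (w : X) {B : Subgroup U} (θ : B →* ℂˣ)
    {L : Subgroup U} [L.Normal] (hLB : L ≤ B) : Prop where
  ne_zero : w ≠ 0
  apply_eq : ∀ b : B, ρ b w = ((θ b : ℂˣ) : ℂ) • w
  sep : ∀ g ∉ B, (θ.comp (Subgroup.inclusion hLB)).comp (MulAut.conjNormal g⁻¹).toMonoidHom ≠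
    θ.comp (Subgroup.inclusion hLB)

/-! ### Clifford vectors and the modules they generate. -/

namespace IsCliffordVec

variable {ρ : Representation ℂ U X} {w : X} {B : Subgroup U} {θ : B →* ℂˣ} {L : Subgroup U}
  [L.Normal] {hLB : L ≤ B}

theorem apply_eq_of_mem (H : IsCliffordVec ρ w θ hLB) (l : L) :
    ρ l w = ((θ.comp (Subgroup.inclusion hLB) l : ℂˣ) : ℂ) • w :=
  H.apply_eq (Subgroup.inclusion hLB l)

/-- This formula drives all that follows: a translate by `g ∉ B` belongs to a different character of
`L` and is killed, while for `g ∈ B` it is a multiple of `w`. -/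
theorem eigenProj_translate (H : IsCliffordVec ρ w θ hLB) (g : U) :
    eigenProj ρ (θ.comp (Subgroup.inclusion hLB)) (ρ g w) =
      (if hg : g ∈ B then ((θ ⟨g, hg⟩ : ℂˣ) : ℂ) else 0) • w := by
  split_ifs with hg
  · rw [H.apply_eq ⟨g, hg⟩, map_smul, eigenProj_self H.apply_eq_of_mem]
  · rw [eigenProj_of_ne (eigen_translate H.apply_eq_of_mem g) (H.sep g hg), zero_smul]

theorem eigenProj_mem_span (H : IsCliffordVec ρ w θ hLB) {u : X}
    (hu : u ∈ (generatedBy ρ w).toSubmodule) :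
    ∃ c : ℂ, eigenProj ρ (θ.comp (Subgroup.inclusion hLB)) u = c • w := by
  induction hu using Submodule.span_induction with
  | mem u hu =>
    obtain ⟨g, rfl⟩ := hu
    exact ⟨_, H.eigenProj_translate g⟩
  | zero => exact ⟨0, by simp⟩
  | add a b _ _ ha hb =>
    obtain ⟨c, hc⟩ := ha
    obtain ⟨d, hd⟩ := hb
    exact ⟨c + d, by rw [map_add, hc, hd, add_smul]⟩
  | smul r a _ ha =>
    obtain ⟨c, hc⟩ := ha
    exact ⟨r * c, by rw [map_smul, hc, mul_smul]⟩

/-- The sum of the conjugates of the eigenprojection is a scalar on the generated module. -/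
theorem sum_conj_eigenProj [Fintype U] (H : IsCliffordVec ρ w θ hLB) {u : X}
    (hu : u ∈ (generatedBy ρ w).toSubmodule) :
    ∑ t : U, ρ t (eigenProj ρ (θ.comp (Subgroup.inclusion hLB)) (ρ t⁻¹ u)) =
      (Nat.card B : ℂ) • u := by
  induction hu using Submodule.span_induction with
  | mem u hu =>
    obtain ⟨g, rfl⟩ := hu
    -- Each surviving term equals `ρ g w`, as `t (t⁻¹ g) = g`; the surviving `t` are counted by `t⁻¹
    -- g ∈ B`, so there are `|B|` of them.
    have h1 : ∀ t : U, ρ t (eigenProj ρ (θ.comp (Subgroup.inclusion hLB)) (ρ t⁻¹ (ρ g w))) =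
        if t⁻¹ * g ∈ B then ρ g w else 0 := fun t => by
      rw [show ρ t⁻¹ (ρ g w) = ρ (t⁻¹ * g) w by rw [map_mul, Module.End.mul_apply],
        H.eigenProj_translate]
      split_ifs with hb
      · rw [← H.apply_eq ⟨t⁻¹ * g, hb⟩, ← Module.End.mul_apply, ← map_mul]; simp
      · simp
    simp_rw [h1]
    rw [← Finset.sum_filter, Finset.sum_const, ← Nat.cast_smul_eq_nsmul ℂ]
    congr 2
    rw [Nat.card_eq_fintype_card, Fintype.card_subtype]
    refine Finset.card_bij (fun t _ => t⁻¹ * g) (by simp) (by simp) fun b hb => ?_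
    exact ⟨g * b⁻¹, by simpa using hb, by simp⟩
  | zero => simp
  | add a b _ _ ha hb => simp only [map_add, Finset.sum_add_distrib, ha, hb, smul_add]
  | smul r a _ ha => simp only [map_smul, ← Finset.smul_sum, ha, smul_comm r]

theorem eigenProj_eq_zero {χ : L →* ℂˣ} (H : IsCliffordVec ρ w θ hLB)
    (hχ : ∀ g : U, (θ.comp (Subgroup.inclusion hLB)).comp (MulAut.conjNormal g⁻¹).toMonoidHom ≠ χ)
    {u : X} (hu : u ∈ (generatedBy ρ w).toSubmodule) : eigenProj ρ χ u = 0 := by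
  induction hu using Submodule.span_induction with
  | mem u hu =>
    obtain ⟨g, rfl⟩ := hu
    exact eigenProj_of_ne (eigen_translate H.apply_eq_of_mem g) (hχ g)
  | zero => simp
  | add a b _ _ ha hb => rw [map_add, ha, hb, add_zero]
  | smul r a _ ha => rw [map_smul, ha, smul_zero]

/-- The conjugates of the projection sum to a nonzero scalar, so some translate of a nonzero `u ∈ W`
has nonzero projection. That projection lies in `W` and is a multiple of the generator `w`. -/
theorem isIrreducible_of_eq_top (H : IsCliffordVec ρ w θ hLB)
    (htop : ∀ u, u ∈ (generatedBy ρ w).toSubmodule) : ρ.IsIrreducible := by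
  have := Fintype.ofFinite U
  have hbot : (⊥ : Subrepresentation ρ) ≠ ⊤ := fun h => by
    have h1 : w ∈ (⊤ : Subrepresentation ρ).toSubmodule := trivial
    rw [← h] at h1
    exact H.ne_zero h1
  refine { exists_pair_ne := ⟨⊥, ⊤, hbot⟩, eq_bot_or_eq_top := fun W => ?_ }
  by_cases hW : ∀ u ∈ W.toSubmodule, u = 0
  · exact Or.inl (Subrepresentation.toSubmodule_injective ((Submodule.eq_bot_iff _).2 hW))
  refine Or.inr ?_
  push Not at hW
  obtain ⟨u, huW, hu0⟩ := hW
  obtain ⟨t, ht⟩ : ∃ t : U,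
      eigenProj ρ (θ.comp (Subgroup.inclusion hLB)) (ρ t⁻¹ u) ≠ 0 := by
    by_contra! hall
    have h1 := H.sum_conj_eigenProj (htop u)
    simp only [hall, map_zero, Finset.sum_const_zero] at h1
    exact (smul_ne_zero (Nat.cast_ne_zero.2 Nat.card_pos.ne') hu0) h1.symm
  obtain ⟨c, hc⟩ := H.eigenProj_mem_span (htop (ρ t⁻¹ u))
  have hmem := eigenProj_mem (θ.comp (Subgroup.inclusion hLB)) W (W.apply_mem_toSubmodule t⁻¹ huW)
  rw [hc] at ht hmem
  have hw : w ∈ W.toSubmodule := (W.toSubmodule.smul_mem_iff (left_ne_zero_of_smul ht)).1 hmem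
  apply Subrepresentation.toSubmodule_injective
  refine (Submodule.eq_top_iff').2 fun v => ?_
  refine (Submodule.span_le.2 ?_ : (generatedBy ρ w).toSubmodule ≤ _) (htop v)
  rintro _ ⟨g, rfl⟩
  exact W.apply_mem_toSubmodule g hw

/-- The projection is the rank-one operator `P u = f(P u) w`, so `ρ g` is `|B|⁻¹` times a sum of
rank-one operators. The trace of the `t`-th is `f(P(t⁻¹ g t w))`, exactly the `t`-th term of the
induced character. -/
theorem character_of_eq_top (H : IsCliffordVec ρ w θ hLB)
    (htop : ∀ u, u ∈ (generatedBy ρ w).toSubmodule) (g : U) :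
    ρ.character g = inducedCharacter B θ g := by
  have := Fintype.ofFinite U
  have hfin : Module.Finite ℂ X := ⟨by
    rw [← (Submodule.eq_top_iff').2 htop]
    exact Submodule.fg_span (Set.finite_range _)⟩
  obtain ⟨f, hf⟩ : ∃ f : X →ₗ[ℂ] ℂ, f w = 1 := by
    obtain ⟨f, hf⟩ := Module.Projective.exists_dual_ne_zero ℂ H.ne_zero
    exact ⟨(f w)⁻¹ • f, by simp [hf]⟩
  let P := eigenProj ρ (θ.comp (Subgroup.inclusion hLB))
  have hP : ∀ u, P u = f (P u) • w := fun u => by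
    obtain ⟨c, hc⟩ := H.eigenProj_mem_span (htop u)
    change P u = c • w at hc
    rw [hc, map_smul, hf, smul_eq_mul, mul_one]
  have hsum : ρ g = (Nat.card B : ℂ)⁻¹ •
      ∑ t : U, (f ∘ₗ P ∘ₗ ρ t⁻¹).smulRight (ρ g (ρ t w)) := by
    ext u
    have h1 := H.sum_conj_eigenProj (htop u)
    have hB : (Nat.card B : ℂ) ≠ 0 := Nat.cast_ne_zero.2 Nat.card_pos.ne'
    rw [LinearMap.smul_apply, LinearMap.sum_apply, eq_inv_smul_iff₀ hB, ← map_smul, ← h1, map_sum]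
    refine Finset.sum_congr rfl fun t _ => ?_
    change ρ g (ρ t (P (ρ t⁻¹ u))) = f (P (ρ t⁻¹ u)) • ρ g (ρ t w)
    rw [hP, map_smul, map_smul, ← hP]
  rw [Representation.character, hsum, map_smul, map_sum, inducedCharacter,
    finsum_eq_sum_of_fintype, smul_eq_mul]
  congr 1
  refine Finset.sum_congr rfl fun t _ => ?_
  rw [LinearMap.trace_smulRight]
  have h2 : ρ t⁻¹ (ρ g (ρ t w)) = ρ (t⁻¹ * g * t) w := by
    rw [map_mul, map_mul, Module.End.mul_apply, Module.End.mul_apply]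
  change f (P (ρ t⁻¹ (ρ g (ρ t w)))) = _
  rw [h2]
  change f (eigenProj ρ _ _) = _
  rw [H.eigenProj_translate, map_smul, hf, smul_eq_mul, mul_one]

theorem mem_generatedBy (ρ : Representation ℂ U X) (w : X) :
    w ∈ (generatedBy ρ w).toSubmodule :=
  Submodule.subset_span ⟨1, by simp⟩

theorem restrict (H : IsCliffordVec ρ w θ hLB) :
    IsCliffordVec (generatedBy ρ w).toRepresentation ⟨w, mem_generatedBy ρ w⟩ θ hLB where
  ne_zero h := H.ne_zero (congrArg Subtype.val h)
  apply_eq b := Subtype.ext (H.apply_eq b)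
  sep := H.sep

theorem mem_generatedBy_restrict (ρ : Representation ℂ U X) (w : X)
    (u : (generatedBy ρ w).toSubmodule) :
    u ∈ (generatedBy (generatedBy ρ w).toRepresentation
      ⟨w, mem_generatedBy ρ w⟩).toSubmodule := by
  obtain ⟨u, hu⟩ := u
  have h1 : (generatedBy ρ w).toSubmodule ≤ (generatedBy (generatedBy ρ w).toRepresentation
      ⟨w, mem_generatedBy ρ w⟩).toSubmodule.map (generatedBy ρ w).toSubmodule.subtype := by
    refine Submodule.span_le.2 ?_
    rintro _ ⟨g, rfl⟩
    exact ⟨_, Submodule.subset_span ⟨g, rfl⟩, rfl⟩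
  obtain ⟨v, hv, hvu⟩ := h1 hu
  have : v = ⟨u, hu⟩ := Subtype.ext hvu
  exact this ▸ hv

/-- The module generated by a Clifford vector is irreducible. -/
theorem isIrreducible (H : IsCliffordVec ρ w θ hLB) :
    (generatedBy ρ w).toRepresentation.IsIrreducible :=
  H.restrict.isIrreducible_of_eq_top (mem_generatedBy_restrict ρ w)

/-- The character of the module generated by a Clifford vector is induced. -/
theorem character_eq (H : IsCliffordVec ρ w θ hLB) (g : U) :
    (generatedBy ρ w).toRepresentation.character g = inducedCharacter B θ g :=
  H.restrict.character_of_eq_top (mem_generatedBy_restrict ρ w) g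

/-- Clifford vectors whose characters are not conjugate on `L` generate non-isomorphic modules. -/
theorem isEmpty_equiv {w' : X} {θ' : B →* ℂˣ} (H : IsCliffordVec ρ w θ hLB)
    (H' : IsCliffordVec ρ w' θ' hLB)
    (hne : ∀ g : U, (θ'.comp (Subgroup.inclusion hLB)).comp (MulAut.conjNormal g⁻¹).toMonoidHom ≠
      θ.comp (Subgroup.inclusion hLB)) :
    IsEmpty ((generatedBy ρ w).toRepresentation.Equiv (generatedBy ρ w').toRepresentation) := by
  refine ⟨fun e => H.restrict.ne_zero (e.toLinearEquiv.injective ?_)⟩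
  rw [map_zero]
  have h1 := map_eigenProj (ρ := (generatedBy ρ w).toRepresentation)
    (σ := (generatedBy ρ w').toRepresentation) (e.toLinearEquiv : _ →ₗ[ℂ] _)
    (fun g v => LinearMap.congr_fun (e.toIntertwiningMap.isIntertwining' g) v)
    (θ.comp (Subgroup.inclusion hLB)) ⟨w, mem_generatedBy ρ w⟩
  rw [eigenProj_self H.restrict.apply_eq_of_mem,
    H'.restrict.eigenProj_eq_zero hne (mem_generatedBy_restrict ρ w' _)] at h1
  exact h1

/-- Modules generated by Clifford vectors with pairwise non-conjugate characters on `L` are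
independent. -/
theorem iSupIndep_generatedBy {ι : Type*} {w : ι → X} {θ : ι → B →* ℂˣ}
    (H : ∀ i, IsCliffordVec ρ (w i) (θ i) hLB)
    (hne : ∀ i j, i ≠ j → ∀ g : U,
      ((θ j).comp (Subgroup.inclusion hLB)).comp (MulAut.conjNormal g⁻¹).toMonoidHom ≠
        (θ i).comp (Subgroup.inclusion hLB)) :
    iSupIndep fun i => (generatedBy ρ (w i)).toSubmodule := by
  have := Fintype.ofFinite U
  intro i
  rw [Submodule.disjoint_def]
  intro u hu hu'
  -- `Q` is the scalar `|B|` on the `i`-th module and zero on all the others.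
  let Q : X →ₗ[ℂ] X := ∑ t : U, ρ t ∘ₗ eigenProj ρ ((θ i).comp (Subgroup.inclusion hLB)) ∘ₗ ρ t⁻¹
  have h1 : Q u = (Nat.card B : ℂ) • u := by
    rw [← (H i).sum_conj_eigenProj hu]
    simp [Q, LinearMap.sum_apply]
  have h2 : (⨆ j, ⨆ (_ : j ≠ i), (generatedBy ρ (w j)).toSubmodule) ≤ LinearMap.ker Q := by
    refine iSup₂_le fun j hj v hv => ?_
    rw [LinearMap.mem_ker, LinearMap.sum_apply]
    refine Finset.sum_eq_zero fun t _ => ?_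
    rw [LinearMap.comp_apply, LinearMap.comp_apply, (H j).eigenProj_eq_zero (hne i j hj.symm)
      ((generatedBy ρ (w j)).apply_mem_toSubmodule _ hv), map_zero]
  rw [h2 hu'] at h1
  exact (smul_eq_zero.1 h1.symm).resolve_left (Nat.cast_ne_zero.2 Nat.card_pos.ne')

end IsCliffordVec

end Clifford

/-! ### Arithmetic of `A` -/

section Arithmetic

variable {R : Type u} [CommRing R] {x : R}

instance [Finite R] : Finite (Ext x) := Finite.of_equiv _ (QuadraticAlgebra.equivProd x 0).symm

theorem isUnit_two_of_charP (R : Type*) [CommRing R] (p : ℕ) [Fact p.Prime] (hp : p ≠ 2)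
    [CharP R p] : IsUnit (2 : R) := by
  obtain ⟨k, hk⟩ := (Fact.out : p.Prime).odd_of_ne_two hp
  have h1 : ((2 * k + 1 : ℕ) : R) = 0 := hk ▸ CharP.cast_eq_zero R p
  push_cast at h1
  exact IsUnit.of_mul_eq_one (-(k : R)) (by linear_combination -h1)

/-- If a primitive character of `R` yields the trivial character `a ↦ μ(a e)` of `A`, then `e` is
zero. -/
theorem eq_zero_of_muChar_eq_one {lam : AddChar R ℂˣ} (hlam : IsPrimitiveChar lam)
    (h2 : IsUnit (2 : R)) {e : Ext x} (he : ∀ a, muChar x lam (a * e) = 1) : e = 0 := by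
  obtain ⟨t, ht⟩ := h2.exists_left_inv
  have key : ∀ e : Ext x, (∀ a, muChar x lam (a * e) = 1) → e.im = 0 := by
    intro e he
    have h1 := hlam (Ideal.span {e.im}) fun a ha => by
      obtain ⟨r, rfl⟩ := Ideal.mem_span_singleton'.1 ha
      -- The factor `t = 1/2` cancels the 2 in `d(r + s y) = 2 s`.
      have h3 := he (algebraMap R (Ext x) (r * t))
      have h4 : dMap x (algebraMap R (Ext x) (r * t) * e) = r * e.im := by
        change 2 * (algebraMap R (Ext x) (r * t) * e).im = _
        simp
        linear_combination r * e.im * ht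
      rwa [muChar, AddChar.compAddMonoidHom_apply, h4] at h3
    simpa using h1
  ext
  -- Multiplication by `y` moves the real coordinate into the imaginary one.
  · have h1 := key (yElt x * e) fun a => by rw [← mul_assoc]; exact he _
    simpa [yElt] using h1
  · exact key e he

variable [IsLocalRing R]

theorem star_mem_iIdeal {a : Ext x} (ha : a ∈ iIdeal x) : star a ∈ iIdeal x := by
  rw [iIdeal, rIdeal, Ideal.span_singleton_pow, Ideal.mem_span_singleton'] at *
  obtain ⟨b, rfl⟩ := ha
  refine ⟨(-1) ^ nilDegree R * star b, ?_⟩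
  rw [star_mul, star_pow, star_yElt, neg_pow]
  ring

variable [Finite R] [hx : Fact (IsLocalRing.maximalIdeal R = Ideal.span {x})]

theorem mul_eq_zero_of_mem {a b : Ext x} (ha : a ∈ iIdeal x) (hb : b ∈ iIdeal x) : a * b = 0 := by
  simpa using star_mul_eq_zero (star_mem_iIdeal ha) hb

/-- The last power in range is `y^(2ℓ-1) = x^(ℓ-1) y`, and `x^(ℓ-1) ≠ 0` by minimality of `ℓ`. -/
theorem yElt_pow_ne_zero {k : ℕ} (hk : k < 2 * nilDegree R) : yElt x ^ k ≠ 0 := by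
  intro h0
  obtain ⟨n, hn⟩ : ∃ n, nilDegree R = n + 1 := ⟨nilDegree R - 1, by omega⟩
  have h1 : yElt x ^ (2 * n + 1) = 0 := pow_eq_zero_of_le (by omega) h0
  rw [pow_succ, pow_mul, yElt_sq, ← map_pow] at h1
  have h2 : x ^ n = 0 := by
    generalize x ^ n = a at h1
    simpa [yElt] using congrArg QuadraticAlgebra.im h1
  have h3 : IsLocalRing.maximalIdeal R ^ n = 0 := by
    rw [hx.out, Ideal.span_singleton_pow, h2]; simp
  have h4 : nilDegree R ≤ n := Nat.sInf_le h3
  omega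

/-- The ideal `𝔦` contains the annihilator of `𝔦`. -/
theorem mem_iIdeal_of_mul_eq_zero {d : Ext x} (hd : yElt x ^ nilDegree R * d = 0) :
    d ∈ iIdeal x := by
  -- Factors of `y` are split off one at a time: were the cofactor a unit at some `k < ℓ`, then
  -- `y^(ℓ+k)` would vanish with `ℓ + k < 2ℓ`.
  have key : ∀ k ≤ nilDegree R, ∃ e, d = yElt x ^ k * e := by
    intro k
    induction k with
    | zero => exact fun _ => ⟨d, by simp⟩
    | succ k ih =>
      intro hk
      obtain ⟨e, he⟩ := ih (by omega)
      by_cases hr : e ∈ rIdeal x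
      · obtain ⟨b, rfl⟩ := Ideal.mem_span_singleton'.1 hr
        exact ⟨b, by rw [he]; ring⟩
      · have hu := isUnit_of_notMem hr
        rw [he, ← mul_assoc, ← pow_add, hu.mul_left_eq_zero] at hd
        exact absurd hd (yElt_pow_ne_zero (by omega))
  obtain ⟨e, he⟩ := key _ le_rfl
  rw [iIdeal, rIdeal, Ideal.span_singleton_pow, Ideal.mem_span_singleton']
  exact ⟨e, by rw [he, mul_comm]⟩

theorem yElt_pow_mem_iIdeal : yElt x ^ nilDegree R ∈ iIdeal x := by
  rw [iIdeal, rIdeal, Ideal.span_singleton_pow]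
  exact Ideal.mem_span_singleton_self _

/-- An element of norm one modulo `𝔦` is congruent to an element of norm one. -/
theorem exists_normOne_sub_mem (h2 : IsUnit (2 : R)) {c : Ext x}
    (hc : c * star c - 1 ∈ iIdeal x) : ∃ z : normOne x, (z : Ext x) - c ∈ iIdeal x := by
  obtain ⟨t, ht⟩ := h2.exists_left_inv
  set T := algebraMap R (Ext x) t with hT
  have hT2 : T * 2 = 1 := by rw [hT, ← map_ofNat (algebraMap R (Ext x)) 2, ← map_mul, ht, map_one]
  have hTs : star T = T := by ext <;> simp [hT]
  set e := c * star c - 1 with he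
  have hes : star e = e := by simp [he, mul_comm]
  have hee : e * e = 0 := mul_eq_zero_of_mem hc hc
  -- Here `T = 1/2`, and since `e² = 0` the element `1 - e/2` is an inverse square root of `c c* = 1
  -- + e`.
  have hz : (c * (1 - T * e)) * star (c * (1 - T * e)) = 1 := by
    have h3 : star (c * (1 - T * e)) = star c * (1 - T * e) := by
      simp [hTs, hes, mul_comm]
    rw [h3]
    linear_combination (1 - T * e) ^ 2 * (-he) + (T ^ 2 + T ^ 2 * e - 2 * T) * hee -
      e * hT2
  refine ⟨⟨c * (1 - T * e), Unitary.mem_iff.2 ⟨by rw [mul_comm]; exact hz, hz⟩⟩, ?_⟩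
  have h4 : c * (1 - T * e) - c = (-c * T) * e := by ring
  change c * (1 - T * e) - c ∈ _
  rw [h4]
  exact Ideal.mul_mem_left _ _ hc

end Arithmetic

/-! ### Transvections and the separation of orbits -/

section Transvection

variable {R : Type u} [CommRing R] [IsLocalRing R] {x : R}
variable {V : Type v} [AddCommGroup V] [Module (Ext x) V] (h : HermForm x V)

/-- The congruence subgroup: the elements of `U` acting trivially on `V / V₀`. -/
def congruenceGrp : Subgroup (unitaryGrp h) := ⨅ w : V, Cgrp h w

theorem mem_congruenceGrp {g : unitaryGrp h} :
    g ∈ congruenceGrp h ↔ ∀ w, g.1 w - w ∈ V0 x V := by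
  simp [congruenceGrp, Subgroup.mem_iInf, Cgrp]

instance : (congruenceGrp h).Normal where
  conj_mem n hn g := by
    rw [mem_congruenceGrp] at *
    intro w
    have h1 := (smul_mem_V0_iff g.1 _).2 (hn ((g⁻¹).1 w))
    rw [map_sub] at h1
    have h2 : g.1 ((g⁻¹).1 w) = w := by
      rw [← LinearEquiv.mul_apply, ← Subgroup.coe_mul]; simp
    rwa [h2] at h1

theorem form_mem_iIdeal (u : V) {w : V} (hw : w ∈ V0 x V) : h.form u w ∈ iIdeal x := by
  refine Submodule.smul_induction_on hw (fun a ha w _ => ?_) (fun w w' h1 h2 => ?_)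
  · rw [map_smul]; exact Ideal.mul_mem_right _ _ ha
  · rw [map_add]; exact Ideal.add_mem _ h1 h2

theorem smul_mem_V0 {a : Ext x} (ha : a ∈ iIdeal x) (w : V) : a • w ∈ V0 x V :=
  Submodule.smul_mem_smul ha trivial

/-- The endomorphism `u ↦ c h(v₂, u) v₁ - c* h(v₁, u) v₂`. -/
def skewMap (c : Ext x) (v₁ v₂ : V) : V →ₗ[Ext x] V :=
  c • (h.form v₂).smulRight v₁ - star c • (h.form v₁).smulRight v₂

theorem skewMap_apply (c : Ext x) (v₁ v₂ u : V) :
    skewMap h c v₁ v₂ u = (c * h.form v₂ u) • v₁ - (star c * h.form v₁ u) • v₂ := by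
  simp [skewMap, smul_smul]

theorem skewMap_mem {c : Ext x} (hc : c ∈ iIdeal x) (v₁ v₂ u : V) :
    skewMap h c v₁ v₂ u ∈ V0 x V := by
  rw [skewMap_apply]
  exact (V0 x V).sub_mem (smul_mem_V0 (Ideal.mul_mem_right _ _ hc) _)
    (smul_mem_V0 (Ideal.mul_mem_right _ _ (star_mem_iIdeal hc)) _)

/-- Together with `form_skewMap_right` this says that `T = skewMap h c v₁ v₂` is skew for `h`:
`h(Tu, w) = -h(u, Tw)`. -/
theorem form_skewMap_left (c : Ext x) (v₁ v₂ u w : V) :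
    h.form (skewMap h c v₁ v₂ u) w =
      star c * h.form u v₂ * h.form v₁ w - c * h.form u v₁ * h.form v₂ w := by
  rw [skewMap_apply, map_sub, LinearMap.sub_apply, LinearMap.map_smulₛₗ₂, LinearMap.map_smulₛₗ₂,
    starRingEnd_apply, starRingEnd_apply, star_mul, star_mul, star_star, ← h.herm, ← h.herm]
  simp only [smul_eq_mul]
  ring

theorem form_skewMap_right (c : Ext x) (v₁ v₂ u w : V) :
    h.form u (skewMap h c v₁ v₂ w) =
      c * h.form u v₁ * h.form v₂ w - star c * h.form u v₂ * h.form v₁ w := by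
  rw [skewMap_apply, map_sub, map_smul, map_smul]
  simp only [smul_eq_mul]
  ring

variable [Finite R] [hx : Fact (IsLocalRing.maximalIdeal R = Ideal.span {x})]

/-- The values of `T` lie in `V₀`, so a second application has coefficients in `𝔦² = 0`. Thus `1 +
T` and `1 - T` are inverse to each other. -/
theorem skewMap_skewMap {c : Ext x} (hc : c ∈ iIdeal x) (v₁ v₂ u : V) :
    skewMap h c v₁ v₂ (skewMap h c v₁ v₂ u) = 0 := by
  have hm := skewMap_mem h hc v₁ v₂ u
  rw [skewMap_apply h c v₁ v₂ (skewMap h c v₁ v₂ u),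
    mul_eq_zero_of_mem hc (form_mem_iIdeal h _ hm),
    mul_eq_zero_of_mem (star_mem_iIdeal hc) (form_mem_iIdeal h _ hm)]
  simp

/-- The element `1 + T` of `U`, where `T u = c h(v₂, u) v₁ - c* h(v₁, u) v₂` with `c` in `𝔦`. -/
def transvection {c : Ext x} (hc : c ∈ iIdeal x) (v₁ v₂ : V) : unitaryGrp h :=
  ⟨LinearEquiv.ofLinearMap (LinearMap.id + skewMap h c v₁ v₂) (LinearMap.id - skewMap h c v₁ v₂)
    (by ext u; simp [skewMap_skewMap h hc]) (by ext u; simp [skewMap_skewMap h hc]), by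
    intro u w
    -- The linear terms cancel because `T` is skew; the quadratic term vanishes because `h(V₀, V₀) =
    -- 0`.
    change h.form (u + skewMap h c v₁ v₂ u) (w + skewMap h c v₁ v₂ w) = _
    rw [map_add, form_add_left, form_add_left, form_eq_zero h (skewMap_mem h hc v₁ v₂ u)
      (skewMap_mem h hc v₁ v₂ w), form_skewMap_left, form_skewMap_right]
    ring⟩

theorem transvection_apply {c : Ext x} (hc : c ∈ iIdeal x) (v₁ v₂ u : V) :
    (transvection h hc v₁ v₂).1 u = u + skewMap h c v₁ v₂ u := rfl

theorem transvection_mem {c : Ext x} (hc : c ∈ iIdeal x) (v₁ v₂ : V) :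
    transvection h hc v₁ v₂ ∈ congruenceGrp h := by
  rw [mem_congruenceGrp]
  intro w
  rw [transvection_apply, add_sub_cancel_left]
  exact skewMap_mem h hc v₁ v₂ w

theorem muChar_sub_star (lam : AddChar R ℂˣ) (a : Ext x) :
    muChar x lam (a - star a) = muChar x lam (2 * a) := by
  have h1 : a - star a = 2 * a + -(a + star a) := by ring
  rw [h1, AddChar.map_add_eq_mul, muChar_eq_one lam (a := -(a + star a)) (by simp [add_comm]),
    mul_one]

/-- As `c`, `v₁` and `v₂` vary, these values of `μ` probe the products `h(u, v₂) h(v₁, u)`. -/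
theorem muChar_transvection (lam : AddChar R ℂˣ) {c : Ext x} (hc : c ∈ iIdeal x) (v₁ v₂ u : V) :
    muChar x lam (h.form ((transvection h hc v₁ v₂).1 u) u) =
      muChar x lam (2 * (star c * (h.form u v₂ * h.form v₁ u))) := by
  rw [transvection_apply, form_add_left, AddChar.map_add_eq_mul,
    muChar_eq_one lam (h.herm u u).symm, one_mul, form_skewMap_left, ← muChar_sub_star]
  congr 2
  · ring
  · rw [star_mul, star_mul, star_star, ← h.herm, ← h.herm]; ring

variable [Module.Free (Ext x) V]

/-- A primitive vector has a unit coordinate, and by non-degeneracy every coordinate function is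
some `h(w, -)`. -/
theorem exists_form_eq_one {s : V} (hs : IsPrimitiveVec x s) : ∃ w, h.form s w = 1 := by
  let b := Module.Free.chooseBasis (Ext x) V
  obtain ⟨j, hj⟩ : ∃ j, b.repr s j ∉ rIdeal x := by
    by_contra! hall
    exact hs (mem_smul_top_of_repr b _ hall)
  obtain ⟨w, hw⟩ := h.nondeg.2 (b.coord j)
  have h1 : IsUnit (h.form s w) := by
    rw [h.herm w s, hw]
    exact (isUnit_of_notMem hj).star
  obtain ⟨a, ha⟩ := h1.exists_left_inv
  exact ⟨a • w, by rw [map_smul, smul_eq_mul, ha]⟩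

theorem mem_V0_of_form_mem {u : V} (hu : ∀ w, h.form w u ∈ iIdeal x) : u ∈ V0 x V := by
  let b := Module.Free.chooseBasis (Ext x) V
  refine mem_smul_top_of_repr b _ fun j => ?_
  obtain ⟨w, hw⟩ := h.nondeg.2 (b.coord j)
  have := hu w
  rwa [hw] at this

variable {lam : AddChar R ℂˣ}

/-- Vectors defining the same character of the congruence subgroup, one of them primitive, are
conjugate under `N` modulo `V₀`. -/
theorem exists_smul_sub_mem (hlam : IsPrimitiveChar lam) (h2 : IsUnit (2 : R)) {s w : V}
    (hs : IsPrimitiveVec x s)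
    (hk : ∀ k ∈ congruenceGrp h, muChar x lam (h.form (k.1 s) s) = muChar x lam (h.form (k.1 w) w)) :
    ∃ z : normOne x, (z : Ext x) • w - s ∈ V0 x V := by
  have key : ∀ v₁ v₂, h.form s v₂ * h.form v₁ s - h.form w v₂ * h.form v₁ w ∈ iIdeal x := by
    intro v₁ v₂
    refine mem_iIdeal_of_mul_eq_zero (eq_zero_of_muChar_eq_one hlam h2 fun a => ?_)
    obtain ⟨t, ht⟩ := h2.exists_left_inv
    have hT2 : algebraMap R (Ext x) t * 2 = 1 := by
      rw [← map_ofNat (algebraMap R (Ext x)) 2, ← map_mul, ht, map_one]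
    -- The coefficient is chosen so that `2 c*` becomes `a y^ℓ` with `a` arbitrary.
    have hc : star (algebraMap R (Ext x) t * a * yElt x ^ nilDegree R) ∈ iIdeal x :=
      star_mem_iIdeal (Ideal.mul_mem_left _ _ yElt_pow_mem_iIdeal)
    have h3 := hk _ (transvection_mem h hc v₁ v₂)
    rw [muChar_transvection, muChar_transvection, star_star, ← div_eq_one,
      ← AddChar.map_sub_eq_div] at h3
    rw [← h3]
    congr 1
    linear_combination (-(a * (yElt x ^ nilDegree R *
      (h.form s v₂ * h.form v₁ s - h.form w v₂ * h.form v₁ w)))) * hT2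
  obtain ⟨v, hv⟩ := exists_form_eq_one h hs
  -- Taking `v₂ = v`, where `h(s, v) = 1`, shows `s ≡ h(w, v) w`. Taking also `v₁ = v` shows that
  -- the scalar has norm one modulo `𝔦`, so it can be corrected to an element of `N`.
  have h3 : h.form w v • w - s ∈ V0 x V := by
    refine mem_V0_of_form_mem h fun v₁ => ?_
    have := key v₁ v
    rw [hv, one_mul, ← neg_mem_iff, neg_sub] at this
    rwa [map_sub, map_smul, smul_eq_mul]
  have h4 : h.form w v * star (h.form w v) - 1 ∈ iIdeal x := by
    have := key v v
    rwa [h.herm s v, h.herm w v, hv, star_one, one_mul, ← neg_mem_iff, neg_sub] at this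
  obtain ⟨z, hz⟩ := exists_normOne_sub_mem h2 h4
  refine ⟨z, ?_⟩
  have h5 := (V0 x V).add_mem (smul_mem_V0 hz w) h3
  rwa [sub_smul, sub_add_sub_cancel] at h5

end Transvection

/-! ### The vectors `e_v` and `E_{φ,v}` -/

section WeilVectors

variable {R : Type u} [CommRing R] [IsLocalRing R] {x : R}
variable {V : Type v} [AddCommGroup V] [Module (Ext x) V] (h : HermForm x V)
variable [Finite R] [hx : Fact (IsLocalRing.maximalIdeal R = Ideal.span {x})]
variable (lam : AddChar R ℂˣ)

/-- Since `mk g 1` stands for `g⁻¹ ⊗ ζ`, this is the relation `g⁻¹ k ⊗ ζ = g⁻¹ ⊗ k ζ`. -/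
theorem mk_inv_mul (k : inducingSubgroup h) (g : HU h) :
    Representation.IndV.mk (inducingSubgroup h).subtype (Zrep h lam) ((k : HU h)⁻¹ * g) 1 =
      ((inducingChar h lam k : ℂˣ) : ℂ) •
        Representation.IndV.mk (inducingSubgroup h).subtype (Zrep h lam) g 1 := by
  have h1 := Representation.Coinvariants.mk_self_apply (Representation.tprod
    ((Representation.leftRegular ℂ (HU h)).comp (inducingSubgroup h).subtype) (Zrep h lam)) k
    (TensorProduct.tmul ℂ (MonoidAlgebra.single ((k : HU h)⁻¹ * g) 1) 1)
  have h2 : Zrep h lam k 1 = ((inducingChar h lam k : ℂˣ) : ℂ) • (1 : ℂ) := rfl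
  rw [Representation.tprod_apply, TensorProduct.map_tmul, h2, TensorProduct.tmul_smul,
    map_smul] at h1
  simp at h1
  exact h1.symm

theorem weilRep_eVec_eq_mk (g : unitaryGrp h) (w : V) :
    weilRep h lam g (eVec h lam w) =
      Representation.IndV.mk (inducingSubgroup h).subtype (Zrep h lam)
        (SemidirectProduct.inr g * SemidirectProduct.inl (⟨0, w⟩ : Heis h) : HU h)⁻¹ 1 := by
  rw [mul_inv_rev]
  exact Representation.ind_mk _ _ _ _ _

theorem weilRep_eVec (g : unitaryGrp h) (w : V) :
    weilRep h lam g (eVec h lam w) = eVec h lam (g.1 w) := by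
  have hk : (SemidirectProduct.inr g : HU h) ∈ inducingSubgroup h := (V0 x V).zero_mem
  have h1 : (SemidirectProduct.inr g * SemidirectProduct.inl (⟨0, w⟩ : Heis h) : HU h) =
      SemidirectProduct.inl (⟨0, g.1 w⟩ : Heis h) * SemidirectProduct.inr g := by
    have : (⟨0, g.1 w⟩ : Heis h) = heisAct h g ⟨0, w⟩ := rfl
    rw [this, SemidirectProduct.inl_aut]
    simp
  have h2 : inducingChar h lam ⟨_, hk⟩ = 1 := (muChar x lam).map_zero_eq_one
  rw [weilRep_eVec_eq_mk, h1, mul_inv_rev]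
  refine (mk_inv_mul h lam ⟨_, hk⟩ _).trans ?_
  rw [h2, Units.val_one, one_smul]
  rfl

theorem muChar_star (a : Ext x) : muChar x lam (star a) = muChar x lam (-a) := by
  have h1 : star a = -a + (a + star a) := by ring
  rw [h1, AddChar.map_add_eq_mul, muChar_eq_one lam (a := a + star a) (by simp [add_comm]),
    mul_one]

/-- One has `g (0, w) = (0, w) k` with `k` in the inducing subgroup and scalar part `h(w, w) - h(w,
g w)`. As `μ` is trivial on symmetric elements and `μ(a*) = μ(-a)`, its value there is `μ(h(g w,
w))`. -/
theorem weilRep_eVec_of_mem {w : V} (g : Cgrp h w) :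
    weilRep h lam g (eVec h lam w) = ((betaChar h lam w g : ℂˣ) : ℂ) • eVec h lam w := by
  let k : HU h := ⟨(⟨0, w⟩ : Heis h)⁻¹ * ⟨0, g.1.1 w⟩, g.1⟩
  have hk : k ∈ inducingSubgroup h := by
    change -w + g.1.1 w ∈ V0 x V
    rw [neg_add_eq_sub]
    exact g.2
  have h1 : (SemidirectProduct.inr g.1 * SemidirectProduct.inl (⟨0, w⟩ : Heis h) : HU h) =
      SemidirectProduct.inl (⟨0, w⟩ : Heis h) * k := by
    ext1
    · change 1 * heisAct h g.1 ⟨0, w⟩ = ⟨0, w⟩ * ((⟨0, w⟩ : Heis h)⁻¹ * ⟨0, g.1.1 w⟩)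
      rw [mul_inv_cancel_left, one_mul]
      rfl
    · change g.1 * 1 = 1 * g.1
      rw [one_mul, mul_one]
  have h2 : inducingChar h lam ⟨k, hk⟩ = betaChar h lam w g := by
    change muChar x lam (-0 + h.form w w + 0 + h.form (-w) (g.1.1 w)) =
      muChar x lam (h.form (g.1.1 w) w)
    have h3 : h.form (-w) (g.1.1 w) = -h.form w (g.1.1 w) := by simp
    rw [h3, neg_zero, zero_add, add_zero, AddChar.map_add_eq_mul,
      muChar_eq_one lam (h.herm w w).symm, one_mul, ← muChar_star, ← h.herm]
  rw [weilRep_eVec_eq_mk, h1, mul_inv_rev]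
  refine (mk_inv_mul h lam ⟨k, hk⟩ _).trans ?_
  rw [h2]
  rfl

/-- There is a linear functional on `X` which detects the coset `w + V₀`. -/
theorem exists_functional (w : V) : ∃ f : WeilModule h lam →ₗ[ℂ] ℂ, f (eVec h lam w) = 1 ∧
    ∀ u, u - w ∉ V0 x V → f (eVec h lam u) = 0 := by
  let a : HU h := SemidirectProduct.inl (⟨0, w⟩ : Heis h)
  -- `F g` is the intended value on `mk g 1`. It is supported on the coset containing `a⁻¹`, and its
  -- equivariance `hF` lets it descend to the coinvariants defining `X`.
  let F : HU h → ℂ := fun g => if hg : g * a ∈ inducingSubgroup h then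
    ((inducingChar h lam ⟨g * a, hg⟩ : ℂˣ) : ℂ)⁻¹ else 0
  have hF : ∀ (k : inducingSubgroup h) (g : HU h),
      ((inducingChar h lam k : ℂˣ) : ℂ) * F (k * g) = F g := by
    intro k g
    have hiff : (k : HU h) * g * a ∈ inducingSubgroup h ↔ g * a ∈ inducingSubgroup h := by
      rw [mul_assoc]
      exact Subgroup.mul_mem_cancel_left _ k.2
    by_cases hg : g * a ∈ inducingSubgroup h
    · have h1 : (⟨(k : HU h) * g * a, hiff.2 hg⟩ : inducingSubgroup h) = k * ⟨g * a, hg⟩ :=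
        Subtype.ext (mul_assoc _ _ _)
      simp only [F, dif_pos hg, dif_pos (hiff.2 hg)]
      rw [h1, map_mul, Units.val_mul, mul_inv, mul_inv_cancel_left₀ (Units.ne_zero _)]
    · simp only [F, dif_neg hg, dif_neg (mt hiff.1 hg), mul_zero]
  let F' : MonoidAlgebra ℂ (HU h) →ₗ[ℂ] ℂ := Finsupp.linearCombination ℂ F ∘ₗ
    (MonoidAlgebra.coeffLinearEquiv ℂ).toLinearMap
  have hF' : ∀ g r, F' (MonoidAlgebra.single g r) = r * F g := fun g r => by
    simp [F', Finsupp.linearCombination_apply]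
  let F'' := F' ∘ₗ (TensorProduct.rid ℂ (MonoidAlgebra ℂ (HU h))).toLinearMap
  have hmk : ∀ g r, F'' (TensorProduct.tmul ℂ (MonoidAlgebra.single g 1) r) = r * F g :=
    fun g r => by simp [F'', hF']
  have hinv : ∀ k : inducingSubgroup h, F'' ∘ₗ (Representation.tprod
      ((Representation.leftRegular ℂ (HU h)).comp (inducingSubgroup h).subtype)
        (Zrep h lam) k) = F'' := by
    intro k
    refine TensorProduct.ext <| MonoidAlgebra.lhom_ext' fun g => LinearMap.ext_ring <|
      LinearMap.ext_ring ?_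
    have h2 : Zrep h lam k 1 = ((inducingChar h lam k : ℂˣ) : ℂ) := by
      change ((inducingChar h lam k : ℂˣ) : ℂ) * 1 = _
      rw [mul_one]
    have h3 : Representation.leftRegular ℂ (HU h) (k : HU h) (MonoidAlgebra.single g 1) =
        MonoidAlgebra.single ((k : HU h) * g) 1 := by simp
    change F'' (TensorProduct.tmul ℂ
      (Representation.leftRegular ℂ (HU h) (k : HU h) (MonoidAlgebra.single g 1))
      (Zrep h lam k 1)) = F'' (TensorProduct.tmul ℂ (MonoidAlgebra.single g 1) 1)
    rw [h2, h3, hmk, hmk, hF, one_mul]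
  refine ⟨Representation.Coinvariants.lift _ F'' hinv, ?_, fun u hu => ?_⟩
  · refine (hmk _ _).trans ?_
    have h1 : (SemidirectProduct.inl (⟨0, w⟩ : Heis h) : HU h)⁻¹ * a = 1 := inv_mul_cancel a
    have h2 : (SemidirectProduct.inl (⟨0, w⟩ : Heis h) : HU h)⁻¹ * a ∈ inducingSubgroup h :=
      h1 ▸ one_mem _
    have h3 : (⟨_, h2⟩ : inducingSubgroup h) = 1 := Subtype.ext h1
    simp only [F, dif_pos h2]
    rw [h3, map_one]
    simp
  · refine (hmk _ _).trans ?_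
    have h2 : (SemidirectProduct.inl (⟨0, u⟩ : Heis h) : HU h)⁻¹ * a ∉ inducingSubgroup h := by
      rw [← map_inv, ← map_mul]
      intro hmem
      apply hu
      rw [← neg_mem_iff, neg_sub, ← neg_add_eq_sub]
      exact hmem
    simp only [F, dif_neg h2, mul_zero]

end WeilVectors

/-! ### The eigenvectors `E_{φ,v}` and the decomposition of `Top(v)`. -/

section TopModules

variable {R : Type u} [CommRing R] [IsLocalRing R] {x : R}
variable {V : Type v} [AddCommGroup V] [Module (Ext x) V] (h : HermForm x V)
variable [Finite R] [hx : Fact (IsLocalRing.maximalIdeal R = Ideal.span {x})]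
variable (lam : AddChar R ℂˣ)

instance finite_unitaryGrp [Module.Finite (Ext x) V] : Finite (unitaryGrp h) := by
  have : Finite V := Module.finite_of_finite (Ext x)
  have : Finite (V ≃ₗ[Ext x] V) := DFunLike.finite _
  exact Subtype.finite

instance normal_range : (normOneHom h).range.Normal where
  conj_mem := by
    rintro _ ⟨z, rfl⟩ g
    exact ⟨z, by rw [← (normOneHom_commute h z g).eq, mul_inv_cancel_right]⟩

/-- The group generated by the congruence subgroup and `N` is contained in `B(w)`. -/
theorem congruenceGrp_sup_le (w : V) :
    congruenceGrp h ⊔ (normOneHom h).range ≤ Bgrp h w :=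
  sup_le_sup_right (iInf_le _ w) _

theorem normOneHom_mem_Cgrp_iff [Module.Free (Ext x) V] {w : V} (hw : IsPrimitiveVec x w)
    (z : normOne x) : normOneHom h z ∈ Cgrp h w ↔ (z : Ext x) - 1 ∈ iIdeal x := by
  refine ⟨sub_one_mem h hw, fun hz => ?_⟩
  have := smul_mem_V0 hz w
  rwa [sub_smul, one_smul] at this

variable {w : V} {δ : normOne x →* ℂˣ} (hδ : ExtendsBeta h lam w δ)

theorem gammaChar_apply (b : Bgrp h w) (c : Cgrp h w) (z : normOne x)
    (hb : (c : unitaryGrp h) * normOneHom h z = b) :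
    gammaChar h lam w δ hδ b = betaChar h lam w c * δ z :=
  glue_apply (normOneHom_commute h) (betaChar h lam w) δ hδ b c z hb

theorem gammaChar_normOne (z : normOne x) (hz : normOneHom h z ∈ Bgrp h w) :
    gammaChar h lam w δ hδ ⟨normOneHom h z, hz⟩ = δ z := by
  rw [gammaChar_apply h lam hδ _ 1 z (by simp), map_one, one_mul]

theorem EVec_eq_sum [Fintype (normOne x)] (φ : charGroup x) :
    EVec h lam w δ hδ φ = ∑ z : normOne x, ((φ.1 z⁻¹ * δ z⁻¹ : ℂˣ) : ℂ) •
      weilRep h lam (normOneHom h z) (eVec h lam w) := by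
  rw [EVec, finsum_eq_sum_of_fintype]
  simp_rw [gammaChar_normOne]

theorem weilRep_normOne_EVec (φ : charGroup x) (n : normOne x) :
    weilRep h lam (normOneHom h n) (EVec h lam w δ hδ φ) =
      ((φ.1 n * δ n : ℂˣ) : ℂ) • EVec h lam w δ hδ φ := by
  have := Fintype.ofFinite (normOne x)
  rw [EVec_eq_sum, map_sum, Finset.smul_sum, ← Equiv.sum_comp (Equiv.mulLeft n)
    (fun z : normOne x => ((φ.1 n * δ n : ℂˣ) : ℂ) • ((φ.1 z⁻¹ * δ z⁻¹ : ℂˣ) : ℂ) •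
      weilRep h lam (normOneHom h z) (eVec h lam w))]
  refine Finset.sum_congr rfl fun z _ => ?_
  rw [map_smul, ← Module.End.mul_apply, ← map_mul, ← map_mul, smul_smul, ← Units.val_mul]
  congr 2
  simp only [Equiv.coe_mulLeft, mul_inv, map_mul, map_inv]
  rw [mul_mul_mul_comm (φ.1 n)⁻¹, ← mul_assoc, ← mul_inv (φ.1 n), mul_inv_cancel, one_mul]

/-- As `N` is central, every `z e_w` is a `β_w`-eigenvector of `C(w)`, just as `e_w` is. -/
theorem weilRep_Cgrp_EVec (φ : charGroup x) (c : Cgrp h w) :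
    weilRep h lam c (EVec h lam w δ hδ φ) =
      ((betaChar h lam w c : ℂˣ) : ℂ) • EVec h lam w δ hδ φ := by
  have := Fintype.ofFinite (normOne x)
  have h1 : ∀ z, weilRep h lam c (weilRep h lam (normOneHom h z) (eVec h lam w)) =
      ((betaChar h lam w c : ℂˣ) : ℂ) • weilRep h lam (normOneHom h z) (eVec h lam w) := by
    intro z
    have h2 : weilRep h lam c (weilRep h lam (normOneHom h z) (eVec h lam w)) =
        weilRep h lam (normOneHom h z) (weilRep h lam c (eVec h lam w)) := by
      rw [← Module.End.mul_apply, ← map_mul, ← (normOneHom_commute h z c).eq, map_mul,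
        Module.End.mul_apply]
    rw [h2, weilRep_eVec_of_mem, map_smul]
  have h3 : EVec h lam w δ hδ φ ∈ LinearMap.eqLocus (weilRep h lam c)
      (((betaChar h lam w c : ℂˣ) : ℂ) • LinearMap.id) := by
    rw [EVec_eq_sum]
    exact Submodule.sum_mem _ fun z _ => Submodule.smul_mem _ _ (h1 z)
  exact h3

variable [Module.Free (Ext x) V]

/-- The functional detecting `w + V₀` sees only the terms with `z w ≡ w`. Each contributes 1, since
`φ` is trivial there and `δ` agrees with `β_w`; the term `z = 1` is among them. -/
theorem EVec_ne_zero (hw : IsPrimitiveVec x w) (φ : charGroup x) :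
    EVec h lam w δ hδ φ ≠ 0 := by
  have := Fintype.ofFinite (normOne x)
  obtain ⟨f, hf1, hf0⟩ := exists_functional h lam w
  have h1 : f (EVec h lam w δ hδ φ) =
      ∑ z : normOne x, if normOneHom h z ∈ Cgrp h w then (1 : ℂ) else 0 := by
    rw [EVec_eq_sum, map_sum]
    refine Finset.sum_congr rfl fun z _ => ?_
    rw [map_smul]
    split_ifs with hz
    · rw [weilRep_eVec_of_mem h lam ⟨_, hz⟩, map_smul, hf1, ← hδ z hz, φ.2 z⁻¹, one_mul,
        smul_eq_mul, smul_eq_mul, mul_one, ← Units.val_mul, ← map_mul]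
      · simp
      · refine (normOneHom_mem_Cgrp_iff h hw _).1 ?_
        rw [map_inv]
        exact inv_mem hz
    · rw [weilRep_eVec, hf0 _ hz, smul_zero]
  intro h0
  rw [h0, map_zero, Finset.sum_boole] at h1
  have h2 := Finset.card_eq_zero.1 (Nat.cast_eq_zero.1 h1.symm)
  exact Finset.eq_empty_iff_forall_notMem.1 h2 1 (by simp [one_mem])

theorem inflate_mul_gammaChar_apply (hw : IsPrimitiveVec x w) (φ : charGroup x) (b : Bgrp h w)
    (c : Cgrp h w) (z : normOne x) (hb : (c : unitaryGrp h) * normOneHom h z = b) :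
    (inflate h w hw φ * gammaChar h lam w δ hδ) b = φ.1 z * (betaChar h lam w c * δ z) := by
  rw [MonoidHom.mul_apply, gammaChar_apply h lam hδ b c z hb, inflate,
    glue_apply _ _ _ _ b c z hb, MonoidHom.one_apply, one_mul]

theorem inflate_mul_gammaChar_normOne (hw : IsPrimitiveVec x w) (φ : charGroup x)
    (z : normOne x) (hz : normOneHom h z ∈ Bgrp h w) :
    (inflate h w hw φ * gammaChar h lam w δ hδ) ⟨normOneHom h z, hz⟩ = φ.1 z * δ z := by
  rw [inflate_mul_gammaChar_apply h lam hδ hw φ _ 1 z (by simp), map_one, one_mul]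

theorem inflate_mul_gammaChar_Cgrp (hw : IsPrimitiveVec x w) (φ : charGroup x)
    (c : Cgrp h w) (hc : c.1 ∈ Bgrp h w) :
    (inflate h w hw φ * gammaChar h lam w δ hδ) ⟨c.1, hc⟩ = betaChar h lam w c := by
  rw [inflate_mul_gammaChar_apply h lam hδ hw φ _ c 1 (by simp), map_one, one_mul, map_one, mul_one]

/-- On the congruence subgroup, `β_w(g⁻¹ k g) = μ(h(k g w, g w))`. Equality of the two characters
would therefore give `z` in `N` with `z g w ≡ w`, that is, `g ∈ C(w) N`. -/
theorem conj_character_ne_of_notMem (hlam : IsPrimitiveChar lam) (h2 : IsUnit (2 : R))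
    (hw : IsPrimitiveVec x w) (φ : charGroup x) {g : unitaryGrp h} (hg : g ∉ Bgrp h w) :
    ((inflate h w hw φ * gammaChar h lam w δ hδ).comp
        (Subgroup.inclusion (congruenceGrp_sup_le h w))).comp
          (MulAut.conjNormal g⁻¹).toMonoidHom ≠
      (inflate h w hw φ * gammaChar h lam w δ hδ).comp
        (Subgroup.inclusion (congruenceGrp_sup_le h w)) := by
  intro heq
  obtain ⟨z, hz⟩ := exists_smul_sub_mem h hlam h2 (w := g.1 w) hw fun k hk => by
    have h3 := DFunLike.congr_fun heq ⟨k, Subgroup.mem_sup_left hk⟩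
    have hk' : g⁻¹ * k * g ∈ congruenceGrp h := by
      simpa using (inferInstance : (congruenceGrp h).Normal).conj_mem k hk g⁻¹
    have hle : congruenceGrp h ≤ Cgrp h w := iInf_le _ w
    have h4 := inflate_mul_gammaChar_Cgrp h lam hδ hw φ ⟨k, hle hk⟩
      (Subgroup.mem_sup_left (hle hk))
    have h5 := inflate_mul_gammaChar_Cgrp h lam hδ hw φ ⟨_, hle hk'⟩
      (Subgroup.mem_sup_left (hle hk'))
    have h6 : (⟨g⁻¹ * k * g, Subgroup.mem_sup_left (hle hk')⟩ : Bgrp h w) =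
        Subgroup.inclusion (congruenceGrp_sup_le h w)
          (MulAut.conjNormal g⁻¹ ⟨k, Subgroup.mem_sup_left hk⟩) := by
      ext1
      rw [Subgroup.coe_inclusion, MulAut.conjNormal_apply, inv_inv]
    have h7 : betaChar h lam w ⟨_, hle hk'⟩ = betaChar h lam w ⟨k, hle hk⟩ := by
      rw [← h5, ← h4, h6]
      exact h3
    have h8 : g.1 ((g⁻¹ * k * g).1 w) = k.1 (g.1 w) := by
      have : g * (g⁻¹ * k * g) = k * g := by group
      exact LinearEquiv.congr_fun (congrArg Subtype.val this) w
    refine h7.symm.trans ?_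
    change muChar x lam (h.form ((g⁻¹ * k * g).1 w) w) = _
    rw [← g.2 ((g⁻¹ * k * g).1 w) w, h8]
  apply hg
  have hmem : g * normOneHom h z ∈ Cgrp h w := by
    rw [← (normOneHom_commute h z g).eq]
    exact hz
  have h3 : g = (g * normOneHom h z) * normOneHom h z⁻¹ := by
    rw [mul_assoc, ← map_mul]; simp
  rw [h3]
  exact mul_mem (Subgroup.mem_sup_left hmem) (Subgroup.mem_sup_right ⟨_, rfl⟩)

theorem isCliffordVec_EVec [Module.Finite (Ext x) V] (hlam : IsPrimitiveChar lam)
    (h2 : IsUnit (2 : R)) (hw : IsPrimitiveVec x w) (φ : charGroup x) :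
    IsCliffordVec (weilRep h lam) (EVec h lam w δ hδ φ)
      (inflate h w hw φ * gammaChar h lam w δ hδ) (congruenceGrp_sup_le h w) where
  ne_zero := EVec_ne_zero h lam hδ hw φ
  apply_eq b := by
    obtain ⟨c, z, hb⟩ := exists_decomp (normOneHom_commute h) b
    rw [inflate_mul_gammaChar_apply h lam hδ hw φ b c z hb, ← hb, map_mul, Module.End.mul_apply,
      weilRep_normOne_EVec, map_smul, weilRep_Cgrp_EVec, smul_smul, ← Units.val_mul]
    congr 2
    rw [mul_assoc, mul_comm (δ z)]
  sep _ := conj_character_ne_of_notMem h lam hδ hlam h2 hw φ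

/-- Conjugation does nothing on the central group `N`, where the two characters are `ψ δ` and `φ δ`.
-/
theorem conj_character_ne_of_ne (hw : IsPrimitiveVec x w) {φ ψ : charGroup x} (hne : φ ≠ ψ)
    (g : unitaryGrp h) :
    ((inflate h w hw ψ * gammaChar h lam w δ hδ).comp
        (Subgroup.inclusion (congruenceGrp_sup_le h w))).comp
          (MulAut.conjNormal g⁻¹).toMonoidHom ≠
      (inflate h w hw φ * gammaChar h lam w δ hδ).comp
        (Subgroup.inclusion (congruenceGrp_sup_le h w)) := by
  intro heq
  refine hne (Subtype.ext (MonoidHom.ext fun z => ?_))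
  have hz : normOneHom h z ∈ congruenceGrp h ⊔ (normOneHom h).range :=
    Subgroup.mem_sup_right ⟨z, rfl⟩
  have h3 := DFunLike.congr_fun heq ⟨_, hz⟩
  have h4 : MulAut.conjNormal g⁻¹ (⟨_, hz⟩ : ↥(congruenceGrp h ⊔ (normOneHom h).range)) =
      ⟨_, hz⟩ := by
    ext1
    rw [MulAut.conjNormal_apply, inv_inv, mul_assoc, (normOneHom_commute h z g).eq,
      inv_mul_cancel_left]
  rw [MonoidHom.comp_apply, MulEquiv.coe_toMonoidHom, h4] at h3
  have h5 := (inflate_mul_gammaChar_normOne h lam hδ hw ψ z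
    (congruenceGrp_sup_le h w hz)).symm.trans (h3.trans
      (inflate_mul_gammaChar_normOne h lam hδ hw φ z (congruenceGrp_sup_le h w hz)))
  exact (mul_right_cancel h5).symm

/-- The sum over the dual of `N / (N ∩ (1 + 𝔦))` of the values at an element outside
`1 + 𝔦` vanishes. -/
theorem sum_charGroup_eq_zero [Fintype (charGroup x)] (hw : IsPrimitiveVec x w) {z : normOne x}
    (hz : normOneHom h z ∉ Cgrp h w) : ∑ φ : charGroup x, ((φ.1 z : ℂˣ) : ℂ) = 0 := by
  refine sum_hom_eq_zero ((MonoidHom.eval z).comp (charGroup x).subtype) fun h1 => hz ?_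
  -- Characters of `N` trivial on the subgroup `N ∩ C(w)` separate it from the elements outside.
  refine (CommGroup.forall_monoidHom_apply_eq_one_iff (M := ℂ)
    ((Cgrp h w).comap (normOneHom h)) z).1 fun φ hφ => ?_
  exact DFunLike.congr_fun h1
    ⟨φ, fun y hy => hφ y ((normOneHom_mem_Cgrp_iff h hw y).2 hy)⟩

/-- Fourier inversion: after summing over `φ`, the coefficient of `z e_w` vanishes unless `z ∈
C(w)`, and then the term is `|G| e_w`. -/
theorem exists_smul_eq_sum_EVec [Fintype (charGroup x)] (hw : IsPrimitiveVec x w) :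
    ∃ c : ℂ, c ≠ 0 ∧ ∑ φ : charGroup x, EVec h lam w δ hδ φ = c • eVec h lam w := by
  have := Fintype.ofFinite (normOne x)
  refine ⟨∑ z : normOne x, if normOneHom h z ∈ Cgrp h w then (Fintype.card (charGroup x) : ℂ)
    else 0, ?_, ?_⟩
  · rw [← Finset.sum_filter, Finset.sum_const, nsmul_eq_mul]
    refine mul_ne_zero (Nat.cast_ne_zero.2 (Finset.card_ne_zero.2 ⟨1, by simp [one_mem]⟩))
      (Nat.cast_ne_zero.2 Fintype.card_ne_zero)
  · simp_rw [EVec_eq_sum]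
    rw [Finset.sum_comm, Finset.sum_smul]
    refine Finset.sum_congr rfl fun z _ => ?_
    rw [← Finset.sum_smul]
    simp_rw [Units.val_mul]
    rw [← Finset.sum_mul]
    split_ifs with hz
    · have hz' : normOneHom h z⁻¹ ∈ Cgrp h w := by
        rw [map_inv]
        exact inv_mem hz
      have h1 : ∀ φ : charGroup x, ((φ.1 z⁻¹ : ℂˣ) : ℂ) = 1 := fun φ => by
        rw [φ.2 z⁻¹ ((normOneHom_mem_Cgrp_iff h hw _).1 hz'), Units.val_one]
      simp_rw [h1]
      rw [weilRep_eVec_of_mem h lam ⟨_, hz⟩, ← hδ z hz, smul_smul, mul_assoc, ← Units.val_mul,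
        ← map_mul, Finset.sum_const, Finset.card_univ]
      simp
    · have hz' : normOneHom h z⁻¹ ∉ Cgrp h w := by
        rwa [map_inv, inv_mem_iff]
      rw [sum_charGroup_eq_zero h hw hz', zero_mul, zero_smul, zero_smul]

theorem generatedBy_le {U X : Type*} [Group U] [AddCommGroup X] [Module ℂ X]
    {ρ : Representation ℂ U X} {w : X} (W : Subrepresentation ρ) (hw : w ∈ W.toSubmodule) :
    (generatedBy ρ w).toSubmodule ≤ W.toSubmodule := by
  refine Submodule.span_le.2 ?_
  rintro _ ⟨g, rfl⟩
  exact W.apply_mem_toSubmodule g hw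

theorem iSup_TopChar [Module.Finite (Ext x) V] (hw : IsPrimitiveVec x w) :
    ⨆ φ : charGroup x, (TopChar h lam w δ hδ φ).toSubmodule = (TopAt h lam w).toSubmodule := by
  have := Fintype.ofFinite (normOne x)
  have := Fintype.ofFinite (charGroup x)
  refine le_antisymm (iSup_le fun φ => generatedBy_le _ ?_) ?_
  · rw [EVec_eq_sum]
    exact Submodule.sum_mem _ fun z _ => Submodule.smul_mem _ _ <|
      (TopAt h lam w).apply_mem_toSubmodule _ (IsCliffordVec.mem_generatedBy _ _)
  · let W : Subrepresentation (weilRep h lam) :=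
      ⟨⨆ φ : charGroup x, (TopChar h lam w δ hδ φ).toSubmodule, fun g v hv => by
        refine (iSup_le fun φ u hu => Submodule.mem_iSup_of_mem φ
          ((TopChar h lam w δ hδ φ).apply_mem_toSubmodule g hu) :
            _ ≤ Submodule.comap (weilRep h lam g)
              (⨆ φ : charGroup x, (TopChar h lam w δ hδ φ).toSubmodule)) hv⟩
    refine generatedBy_le W ?_
    obtain ⟨c, hc, hsum⟩ := exists_smul_eq_sum_EVec h lam hδ hw
    refine (W.toSubmodule.smul_mem_iff hc).1 ?_
    rw [← hsum]
    exact Submodule.sum_mem _ fun φ _ =>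
      Submodule.mem_iSup_of_mem φ (IsCliffordVec.mem_generatedBy _ _)

end TopModules

end RamifiedWeil

end

theorem mainTheorem4
    {R : Type*} [CommRing R] [Finite R] [IsLocalRing R] [IsPrincipalIdealRing R]
    (p : ℕ) [Fact p.Prime] (hp : p ≠ 2) [CharP R p]
    (x : R) [Fact (IsLocalRing.maximalIdeal R = Ideal.span {x})]
    {V : Type*} [AddCommGroup V] [Module (RamifiedWeil.Ext x) V]
    [Module.Free (RamifiedWeil.Ext x) V] [Module.Finite (RamifiedWeil.Ext x) V] [Nontrivial V]
    (h : RamifiedWeil.HermForm x V)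
    (lam : AddChar R ℂˣ) (hlam : RamifiedWeil.IsPrimitiveChar lam)
    (S : Set V) (hS : RamifiedWeil.IsRepresentatives h S) (s : V) (hs : s ∈ S)
    (δ : RamifiedWeil.normOne x →* ℂˣ) (hδ : RamifiedWeil.ExtendsBeta h lam s δ) :
    (∀ (φ : RamifiedWeil.charGroup x) (g : RamifiedWeil.unitaryGrp h),
      (RamifiedWeil.TopChar h lam s δ hδ φ).toRepresentation.character g =
        RamifiedWeil.inducedCharacter (RamifiedWeil.Bgrp h s)
          (RamifiedWeil.inflate h s (hS.1 s hs) φ * RamifiedWeil.gammaChar h lam s δ hδ) g) ∧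
    (∀ φ : RamifiedWeil.charGroup x,
      (RamifiedWeil.TopChar h lam s δ hδ φ).toRepresentation.IsIrreducible) ∧
    (∀ φ ψ : RamifiedWeil.charGroup x, φ ≠ ψ →
      IsEmpty ((RamifiedWeil.TopChar h lam s δ hδ φ).toRepresentation.Equiv
        (RamifiedWeil.TopChar h lam s δ hδ ψ).toRepresentation)) ∧
    (iSupIndep (fun φ : RamifiedWeil.charGroup x =>
        (RamifiedWeil.TopChar h lam s δ hδ φ).toSubmodule) ∧
      (⨆ φ : RamifiedWeil.charGroup x, (RamifiedWeil.TopChar h lam s δ hδ φ).toSubmodule) =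
        (RamifiedWeil.TopAt h lam s).toSubmodule) := by
  have h2 := RamifiedWeil.isUnit_two_of_charP R p hp
  have hw := hS.1 s hs
  have H := RamifiedWeil.isCliffordVec_EVec h lam hδ hlam h2 hw
  have hne := fun φ ψ : RamifiedWeil.charGroup x =>
    RamifiedWeil.conj_character_ne_of_ne h lam hδ hw (φ := φ) (ψ := ψ)
  exact ⟨fun φ g => (H φ).character_eq g, fun φ => (H φ).isIrreducible,
    fun φ ψ hφψ => (H φ).isEmpty_equiv (H ψ) (hne φ ψ hφψ),
    RamifiedWeil.IsCliffordVec.iSupIndep_generatedBy H hne,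
    RamifiedWeil.iSup_TopChar h lam hδ hw⟩
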